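/- All graphs are finite and simple. A multiset $\mathscr P$ of paths of a graph $G$ is a \emph{$k$-rainbow separating path system} ($k$-RSPS), $k\in\{2,3,\dots\}$, if its elements can be coloured with $k$ colours so that for every two distinct edges $e_1,e_2$ of $G$ there are paths $P_1,P_2\in\mathscr P$ of distinct colours with $e_1\in P_1\not\ni e_2$ and $e_2\in P_2\not\ni e_1$; let $c_k(G)$ be the least cardinality of a $k$-RSPS of $G$. Let $c_\infty(G)$ be the least size of a strongly separating path system of $G$, i.e. a set of paths such that for every ordered pair $(e,f)$ of distinct edges some path of the set contains $e$ and avoids $f$. Put $r_k(G)=c_k(G)/c_\infty(G)$ and, for an infinite class $\Sigma$ of graphs, $r_k(\Sigma)=\limsup_{G\in\Sigma}r_k(G)$. The class $\Sigma$ is \emph{rainbow separable} if for every $\varepsilon>0$ there is $k\in\{2,3,\dots\}$ with $r_k(\Sigma)<1+\varepsilon$, and its \emph{chromatic separation number} is $\chi_{rs}(\Sigma)=\min\{k\in\{2,3,\dots\}\cup\{\infty\} : r_k(\Sigma)=1\}$. A \emph{complete binary tree} is a rooted tree in which every vertex has either no child or exactly two children, and all leaves have the same distance from the root. Let $\mathcal{BT}$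 be the class of complete binary trees. \textbf{Theorem.} The class $\mathcal{BT}$ is rainbow separable, but $\chi_{rs}(\mathcal{BT})=\infty$. More precisely, for every $k\in\{2,3,\dots\}$ there is $n_0=n_0(k)$ such that for every complete binary tree $T$ on $n\ge n_0$ vertices (i) every $k$-RSPS of $T$ has at least $\left(1+16^{-(k+6)}\right)c_\infty(T)$ paths; (ii) $T$ has a $k$-RSPS with at most $\dfrac{n+1}{k}\cdot\dfrac{k+2\log_2 k+6}{2}$ paths. Moreover, $r_k(\mathcal{BT})\to 1$ as $k\to\infty$. -/

import Mathlib

open Filter Topology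
open scoped ENNReal

noncomputable section

namespace RainbowSep

/-- The paths of a simple graph, as (unoriented) subgraphs. -/
def GraphPath {V : Type*} (G : SimpleGraph V) : Type _ :=
  {H : G.Subgraph // ∃ (u v : V) (p : G.Walk u v), p.IsPath ∧ H = p.toSubgraph}

/-- The edges of a path. -/
def GraphPath.edges {V : Type*} {G : SimpleGraph V} (P : GraphPath G) : Set (Sym2 V) :=
  P.1.edgeSet

/-- A set of paths is strongly separating if for every ordered pair `(e, f)` of distinct edges
some path contains `e` and avoids `f`. -/
def IsStronglySeparating {V : Type*} {G : SimpleGraph V} (S : Finset (GraphPath G)) : Prop :=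
  ∀ e ∈ G.edgeSet, ∀ f ∈ G.edgeSet, e ≠ f → ∃ P ∈ S, e ∈ P.edges ∧ f ∉ P.edges

/-- The strong separation number. -/
def ssp {V : Type*} (G : SimpleGraph V) : ℕ :=
  sInf {m | ∃ S : Finset (GraphPath G), IsStronglySeparating S ∧ S.card = m}

/-- A multiset `S` of paths is a `k`-rainbow separating path system if its elements can be coloured
with `k` colours (the coloured multiset is `C`) so that any two distinct edges are separated from
each other by two paths of distinct colours. -/
def IsRSPS {V : Type*} {G : SimpleGraph V} (k : ℕ) (S : Multiset (GraphPath G)) : Prop :=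
  ∃ C : Multiset (GraphPath G × Fin k), C.map Prod.fst = S ∧
    ∀ e ∈ G.edgeSet, ∀ f ∈ G.edgeSet, e ≠ f →
      ∃ P ∈ C, ∃ Q ∈ C, P.2 ≠ Q.2 ∧
        (e ∈ P.1.edges ∧ f ∉ P.1.edges) ∧ (f ∈ Q.1.edges ∧ e ∉ Q.1.edges)

/-- The `k`-rainbow separation number `c_k(G)` for `k ∈ {2, 3, …} ∪ {∞}`, where
`c_∞(G) = ssp(G)`. For finite `G` and these `k` the infimum is over a nonempty set. -/
def rainbowSepNumber {V : Type*} (G : SimpleGraph V) (k : ℕ∞) : ℕ :=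
  if k = ⊤ then ssp G
  else sInf {m | ∃ S : Multiset (GraphPath G), IsRSPS k.toNat S ∧ S.card = m}

/-- The `k`-rainbow separation ratio `r_k(G) = c_k(G) / c_∞(G)`. -/
def ratio {V : Type*} (G : SimpleGraph V) (k : ℕ∞) : ℝ≥0∞ :=
  (rainbowSepNumber G k : ℝ≥0∞) / (rainbowSepNumber G ⊤ : ℝ≥0∞)

/-- Finite graphs, with vertex set `{0, …, n - 1}`. There are finitely many of each order. -/
abbrev FinGraph : Type := Σ n : ℕ, SimpleGraph (Fin n)

/-- The `k`-rainbow separation ratio of a class of graphs: the upper limit of `r_k(G)` over the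
members `G` of the class (finitely many members being negligible). -/
def classRatio (A : Set FinGraph) (k : ℕ∞) : ℝ≥0∞ :=
  limsup (fun G : FinGraph => ratio G.2 k) (cofinite ⊓ 𝓟 A)

/-- A class of graphs is rainbow separable if its ratios come arbitrarily close to `1`. -/
def IsRainbowSeparable (A : Set FinGraph) : Prop :=
  ∀ ε : ℝ, 0 < ε → ∃ k : ℕ, 2 ≤ k ∧ classRatio A (k : ℕ∞) < 1 + ENNReal.ofReal ε

/-- The chromatic separation number of a class of graphs. -/
def chromaticSepNumber (A : Set FinGraph) : ℕ∞ :=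
  sInf {k : ℕ∞ | 2 ≤ k ∧ classRatio A k = 1}

/-- Degree of a vertex. -/
def deg {V : Type*} (G : SimpleGraph V) (v : V) : ℕ := (G.neighborSet v).ncard

/-- A complete binary tree: a tree with a root that has two children (or none, for the tree with
one vertex), such that every vertex other than the root is a leaf or has degree `3`, and all leaves
have the same distance from the root. -/
def IsCompleteBinaryTree {V : Type*} (G : SimpleGraph V) : Prop :=
  G.IsTree ∧ ∃ root : V, (deg G root = 0 ∨ deg G root = 2) ∧
    (∀ v, v ≠ root → deg G v = 1 ∨ deg G v = 3) ∧
    ∃ d : ℕ, ∀ v, deg G v = 1 → G.dist root v = d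

/-- The class of complete binary trees. -/
def completeBinaryTrees : Set FinGraph := {G | IsCompleteBinaryTree G.2}

end RainbowSep

end

open RainbowSep

/-! Lower bound: path ends are counted. In a separating family the subtree below any non-root inner
vertex contains at least two ends per leaf; this is checked for a vertex with two leaf children
(`height_one`) and added up over subtrees. Equality is rigid (`endsBelow_tight`): no path ends at an
inner vertex of the subtree, each edge in it or just above its root lies in exactly two paths, and a
path entering it runs down to a leaf. If such a subtree has height `k`, the entering path contains
`k + 1` edges, each lying in just one further path. With `k` colours, two of these further paths
have the same colour by pigeonhole. The entering path cannot separate the two edges concerned, so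
they are not rainbow separated. Hence each subtree of height `k` has at least one extra end
(`endsBelow_rainbow`), which gives a surplus of about `2 ^ (d - k - 1)` over the `2 ^ d` paths
needed anyway.

Upper bound: cut the tree at level `q = d - h`, where `2 ^ h + 1 ≤ k`. In each subtree of height `h`
join consecutive leaves, using the root as a neighbour of the first and of the last leaf, and give
these `2 ^ h + 1` paths distinct colours. The leaves below an edge form an interval, so the edge
lies in exactly the two paths at the ends of this interval, and distinct edges have distinct pairs.
The edges above the cut are few and are taken as single-edge paths in two colours. For `2 ^ h` of
order `k` this costs at most `2 ^ d * (1 + 10 / k)` paths (`exists_small_isRSPS`).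

The construction with very many colours also bounds the strong separation number from above, closely
enough for the surplus to remain when dividing by it. -/

/-- The trace of a family of paths on the complete binary tree of depth `d` with vertices
`1, …, 2 ^ (d + 1) - 1`, where `x` has the children `2 * x` and `2 * x + 1`. The edge between `w`
and its parent is named `w`. The members have end vertices `src`, `tgt` and edges `has`. -/
structure HeapPathFamily (d : ℕ) (ι : Type*) where
  src : ι → ℕ
  tgt : ι → ℕ
  has : ι → ℕ → Prop
  end_leaf : ∀ i x, 2 ^ d ≤ x → x < 2 ^ (d + 1) → has i x → src i = x ∨ tgt i = x
  end_up : ∀ i x, 2 ≤ x → x < 2 ^ d → has i x →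
    (src i = x ∨ tgt i = x) ∨ has i (2 * x) ∨ has i (2 * x + 1)
  end_left : ∀ i x, 2 ≤ x → x < 2 ^ d → has i (2 * x) →
    (src i = x ∨ tgt i = x) ∨ has i (2 * x + 1) ∨ has i x
  end_right : ∀ i x, 2 ≤ x → x < 2 ^ d → has i (2 * x + 1) →
    (src i = x ∨ tgt i = x) ∨ has i (2 * x) ∨ has i x

/-! ### Counting path ends: the lower bounds -/

namespace HeapPathFamily

open Classical in
/-- The number of members that end in `x`, counted twice if both ends are `x`. -/
noncomputable def ends {d : ℕ} {ι : Type*} [Fintype ι] (F : HeapPathFamily d ι) (x : ℕ) : ℕ :=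
  ∑ i, ((if F.src i = x then 1 else 0) + (if F.tgt i = x then 1 else 0))

open Classical in
/-- The members that contain the edge `w`. -/
noncomputable def through {d : ℕ} {ι : Type*} [Fintype ι] (F : HeapPathFamily d ι) (w : ℕ) :
    Finset ι :=
  Finset.univ.filter fun i => F.has i w

/-- The number of path ends in the first `j + 1` levels of the subtree rooted at `x`. -/
noncomputable def endsBelow {d : ℕ} {ι : Type*} [Fintype ι] (F : HeapPathFamily d ι) :
    ℕ → ℕ → ℕ
  | 0, x => F.ends x
  | j + 1, x => F.ends x + (F.endsBelow j (2 * x) + F.endsBelow j (2 * x + 1))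

/-- Every edge is separated from every other edge. -/
def Separates {d : ℕ} {ι : Type*} (F : HeapPathFamily d ι) : Prop :=
  ∀ w w', 2 ≤ w → w < 2 ^ (d + 1) → 2 ≤ w' → w' < 2 ^ (d + 1) → w ≠ w' →
    ∃ i, F.has i w ∧ ¬ F.has i w'

/-- Any two edges are separated by members of distinct colours. -/
def RainbowSeparates {d : ℕ} {ι : Type*} (F : HeapPathFamily d ι) {k : ℕ} (c : ι → Fin k) :
    Prop :=
  ∀ w w', 2 ≤ w → w < 2 ^ (d + 1) → 2 ≤ w' → w' < 2 ^ (d + 1) → w ≠ w' →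
    ∃ i j, c i ≠ c j ∧ (F.has i w ∧ ¬ F.has i w') ∧ (F.has j w' ∧ ¬ F.has j w)

variable {d : ℕ} {ι : Type*} [Fintype ι] (F : HeapPathFamily d ι)

theorem RainbowSeparates.separates {d : ℕ} {ι : Type*} {F : HeapPathFamily d ι} {k : ℕ}
    {c : ι → Fin k} (h : F.RainbowSeparates c) : F.Separates := by
  intro w w' h1 h2 h3 h4 h5
  obtain ⟨i, j, -, hi, -⟩ := h w w' h1 h2 h3 h4 h5
  exact ⟨i, hi⟩

theorem mem_through {i : ι} {w : ℕ} : i ∈ F.through w ↔ F.has i w := by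
  simp [through]

theorem card_le_ends (s : Finset ι) (x : ℕ) (h : ∀ i ∈ s, F.src i = x ∨ F.tgt i = x) :
    s.card ≤ F.ends x := by
  classical
  rw [Finset.card_eq_sum_ones, ends]
  refine (Finset.sum_le_sum ?_).trans (Finset.sum_le_sum_of_subset (Finset.subset_univ s))
  intro i hi
  rcases h i hi with h | h <;> simp [h]

theorem not_end_of_ends_eq_zero {x : ℕ} (h : F.ends x = 0) (i : ι) :
    ¬ (F.src i = x ∨ F.tgt i = x) := by
  intro hi
  have := F.card_le_ends {i} x (by simpa using hi)
  simp [h] at this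

theorem sum_if_eq_one_le (f : ι → ℕ) (s : Finset ℕ) :
    ∑ x ∈ s, ∑ i, (if f i = x then 1 else 0) ≤ Fintype.card ι := by
  rw [Finset.sum_comm, Fintype.card, Finset.card_eq_sum_ones]
  refine Finset.sum_le_sum fun i _ => ?_
  rw [Finset.sum_ite_eq]
  split_ifs <;> simp

theorem sum_ends_le (s : Finset ℕ) : ∑ x ∈ s, F.ends x ≤ 2 * Fintype.card ι := by
  have h1 := sum_if_eq_one_le F.src s
  have h2 := sum_if_eq_one_le F.tgt s
  have : ∑ x ∈ s, F.ends x = ∑ x ∈ s, ∑ i, (if F.src i = x then 1 else 0) +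
      ∑ x ∈ s, ∑ i, (if F.tgt i = x then 1 else 0) := by
    rw [← Finset.sum_add_distrib]
    refine Finset.sum_congr rfl fun x _ => ?_
    rw [← Finset.sum_add_distrib, ends]
  omega

theorem sum_Ico_two_mul (f : ℕ → ℕ) (a b : ℕ) (hab : a ≤ b) :
    ∑ x ∈ Finset.Ico (2 * a) (2 * b), f x =
      ∑ x ∈ Finset.Ico a b, (f (2 * x) + f (2 * x + 1)) := by
  induction b, hab using Nat.le_induction with
  | base => simp
  | succ b hb ih =>
    rw [Finset.sum_Ico_succ_top hb, ← ih, show 2 * (b + 1) = 2 * b + 1 + 1 by ring,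
      Finset.sum_Ico_succ_top (by omega), Finset.sum_Ico_succ_top (by omega)]
    ring

theorem endsBelow_level (l : ℕ) : ∀ j,
    ∑ x ∈ Finset.Ico (2 ^ l) (2 ^ (l + 1)), F.endsBelow j x =
      ∑ x ∈ Finset.Ico (2 ^ l) (2 ^ (l + j + 1)), F.ends x := by
  intro j
  induction j generalizing l with
  | zero => rfl
  | succ j ih =>
    simp only [endsBelow, Finset.sum_add_distrib]
    rw [← Finset.sum_add_distrib, ← sum_Ico_two_mul (F.endsBelow j) _ _
      (Nat.pow_le_pow_right (by norm_num) (by omega)), ← pow_succ', ← pow_succ', ih (l + 1),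
      Finset.sum_Ico_consecutive]
    · congr 3; ring
    · exact Nat.pow_le_pow_right (by norm_num) (by omega)
    · exact Nat.pow_le_pow_right (by norm_num) (by omega)

theorem endsBelow_root_le : F.endsBelow d 1 ≤ 2 * Fintype.card ι := by
  have h := F.endsBelow_level 0 d
  simp only [pow_zero, zero_add, pow_one, Nat.Ico_succ_singleton, Finset.sum_singleton] at h
  rw [h]
  exact F.sum_ends_le _

/-- A leaf edge that lies in only one member forces a surplus of ends at the parent. -/
theorem leaf_edge_once {x y z : ℕ} (hy2 : 2 ≤ y) (hy : y < 2 ^ (d + 1)) (hz2 : 2 ≤ z)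
    (hz : z < 2 ^ (d + 1)) (hx2 : 2 ≤ x) (hx : x < 2 ^ (d + 1)) (hyz : y ≠ z) (hxy : x ≠ y)
    (hxz : x ≠ z)
    (e1 : ∀ i, F.has i x → (F.src i = x ∨ F.tgt i = x) ∨ F.has i y ∨ F.has i z)
    (e2 : ∀ i, F.has i y → (F.src i = x ∨ F.tgt i = x) ∨ F.has i z ∨ F.has i x)
    (e3 : ∀ i, F.has i z → (F.src i = x ∨ F.tgt i = x) ∨ F.has i y ∨ F.has i x)
    (hs : F.Separates) (h : (F.through y).card < 2) :
    (F.through y).card = 1 ∧ 1 ≤ (F.through z).card ∧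
      5 ≤ F.ends x + (F.through y).card + (F.through z).card := by
  classical
  obtain ⟨i, hi, hi'⟩ := hs y z hy2 hy hz2 hz hyz
  obtain ⟨i₂, hi₂, hi₂'⟩ := hs y x hy2 hy hx2 hx hxy.symm
  obtain ⟨j, hj, hj'⟩ := hs z x hz2 hz hx2 hx hxz.symm
  obtain ⟨l, hl, hl'⟩ := hs x y hx2 hx hy2 hy hxy
  have uniq : ∀ a, F.has a y → a = i := by
    intro a ha
    have := Finset.card_le_one.1 (Nat.lt_succ_iff.1 h) a (F.mem_through.2 ha) i
      (F.mem_through.2 hi)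
    exact this
  have h22 := uniq _ hi₂
  subst h22
  have hpos : 1 ≤ (F.through y).card := Finset.card_pos.2 ⟨i₂, F.mem_through.2 hi⟩
  have hposz : 1 ≤ (F.through z).card := Finset.card_pos.2 ⟨j, F.mem_through.2 hj⟩
  have hij : i₂ ≠ j := by rintro rfl; exact hi' hj
  have hjy : ¬ F.has j y := fun hh => hij (uniq j hh).symm
  -- The only member through `y` must avoid both `x` and `z`, so it ends at the common vertex; `j`
  -- avoids `y` since it differs from that member, so it ends there too.
  have ei : F.src i₂ = x ∨ F.tgt i₂ = x := by
    rcases e2 i₂ hi with h | h | h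
    · exact h
    · exact absurd h hi'
    · exact absurd h hi₂'
  have ej : F.src j = x ∨ F.tgt j = x := by
    rcases e3 j hj with h | h | h
    · exact h
    · exact absurd h hjy
    · exact absurd h hj'
  refine ⟨by omega, hposz, ?_⟩
  by_cases hz1 : 2 ≤ (F.through z).card
  · have := F.card_le_ends {i₂, j} x (by simp [ei, ej])
    rw [Finset.card_pair hij] at this
    omega
  -- If `z` is also covered once, a member through `x` avoiding `y` cannot continue into `z` either,
  -- so it supplies a third end.
  · have uniqz : ∀ a, F.has a z → a = j := fun a ha =>
      Finset.card_le_one.1 (by omega) a (F.mem_through.2 ha) j (F.mem_through.2 hj)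
    have hli : i₂ ≠ l := by rintro rfl; exact hi₂' hl
    have hlj : j ≠ l := by rintro rfl; exact hj' hl
    have el : F.src l = x ∨ F.tgt l = x := by
      rcases e1 l hl with h | h | h
      · exact h
      · exact absurd h hl'
      · exact absurd (uniqz l h).symm hlj
    have := F.card_le_ends {i₂, j, l} x (by simp [ei, ej, el])
    rw [Finset.card_eq_three.2 ⟨i₂, j, l, hij, hli, hlj, rfl⟩] at this
    omega

/-- A member through a leaf edge ends in the leaf, so two members through each leaf edge give four
ends. A leaf edge covered only once is overcompensated by ends at `x`, so equality excludes that
case. -/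
theorem height_one (hs : F.Separates) {x : ℕ} (hx2 : 2 ≤ x) (hx : 2 ^ d ≤ 2 * x)
    (hx' : x < 2 ^ d) :
    4 ≤ F.endsBelow 1 x ∧ (F.endsBelow 1 x = 4 →
      F.ends x = 0 ∧ (F.through (2 * x)).card = 2 ∧ (F.through (2 * x + 1)).card = 2) := by
  have hp : 2 ^ (d + 1) = 2 * 2 ^ d := pow_succ' 2 d
  have l1 : (F.through (2 * x)).card ≤ F.ends (2 * x) :=
    F.card_le_ends _ _ fun i hi => F.end_leaf i _ hx (by omega) (F.mem_through.1 hi)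
  have l2 : (F.through (2 * x + 1)).card ≤ F.ends (2 * x + 1) :=
    F.card_le_ends _ _ fun i hi => F.end_leaf i _ (by omega) (by omega) (F.mem_through.1 hi)
  simp only [endsBelow]
  by_cases ha : (F.through (2 * x)).card < 2
  · obtain ⟨-, -, h⟩ := F.leaf_edge_once (x := x) (y := 2 * x) (z := 2 * x + 1) (by omega)
      (by omega) (by omega) (by omega) hx2 (by omega) (by omega) (by omega) (by omega)
      (fun i => F.end_up i x hx2 hx') (fun i => F.end_left i x hx2 hx')
      (fun i => F.end_right i x hx2 hx') hs ha
    omega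
  by_cases hb : (F.through (2 * x + 1)).card < 2
  · obtain ⟨-, -, h⟩ := F.leaf_edge_once (x := x) (y := 2 * x + 1) (z := 2 * x) (by omega)
      (by omega) (by omega) (by omega) hx2 (by omega) (by omega) (by omega) (by omega)
      (fun i h => (F.end_up i x hx2 hx' h).imp_right Or.symm) (fun i => F.end_right i x hx2 hx')
      (fun i => F.end_left i x hx2 hx') hs hb
    omega
  omega

/-- Since nothing ends at `x`, separation forces one member to turn from child to child, one to go
up from the left and one to go up from the right. These three exhaust the members through the child
edges, so exactly the last two use the edge above. -/
theorem card_through_eq_two (hs : F.Separates) {x : ℕ} (hx2 : 2 ≤ x) (hx' : x < 2 ^ d)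
    (h0 : F.ends x = 0) (h1 : (F.through (2 * x)).card = 2)
    (h2 : (F.through (2 * x + 1)).card = 2) : (F.through x).card = 2 := by
  classical
  have hp : 2 ^ (d + 1) = 2 * 2 ^ d := pow_succ' 2 d
  have hend := F.not_end_of_ends_eq_zero h0
  obtain ⟨a, ha, ha'⟩ := hs (2 * x) x (by omega) (by omega) (by omega) (by omega) (by omega)
  obtain ⟨b, hb, hb'⟩ := hs (2 * x) (2 * x + 1) (by omega) (by omega) (by omega) (by omega)
    (by omega)
  obtain ⟨c, hc, hc'⟩ := hs (2 * x + 1) (2 * x) (by omega) (by omega) (by omega) (by omega)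
    (by omega)
  have hay : F.has a (2 * x + 1) := by
    rcases F.end_left a x hx2 hx' ha with h | h | h
    exacts [absurd h (hend a), h, absurd h ha']
  have hbx : F.has b x := by
    rcases F.end_left b x hx2 hx' hb with h | h | h
    exacts [absurd h (hend b), absurd h hb', h]
  have hcx : F.has c x := by
    rcases F.end_right c x hx2 hx' hc with h | h | h
    exacts [absurd h (hend c), absurd h hc', h]
  have hab : a ≠ b := by rintro rfl; exact ha' hbx
  have hac : a ≠ c := by rintro rfl; exact ha' hcx
  have hbc : b ≠ c := by rintro rfl; exact hc' hb
  have e1 : {a, b} = F.through (2 * x) := Finset.eq_of_subset_of_card_le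
    (by intro i hi; rw [mem_through]; simp at hi; rcases hi with rfl | rfl <;> assumption)
    (by rw [h1, Finset.card_pair hab])
  have e2 : {a, c} = F.through (2 * x + 1) := Finset.eq_of_subset_of_card_le
    (by intro i hi; rw [mem_through]; simp at hi; rcases hi with rfl | rfl <;> assumption)
    (by rw [h2, Finset.card_pair hac])
  have e3 : F.through x = {b, c} := by
    ext i
    rw [mem_through, Finset.mem_insert, Finset.mem_singleton]
    constructor
    · intro hi
      have hia : i ≠ a := by rintro rfl; exact ha' hi
      rcases F.end_up i x hx2 hx' hi with h | h | h
      · exact absurd h (hend i)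
      · rw [← mem_through, ← e1] at h; simp [hia] at h; exact Or.inl h
      · rw [← mem_through, ← e2] at h; simp [hia] at h; exact Or.inr h
    · rintro (rfl | rfl) <;> assumption
  rw [e3, Finset.card_pair hbc]

/-- If the subtree at `x` contains as few path ends as possible, then the edges in it lie in
exactly two members, and the members through the edge above `x` go down to a leaf. -/
theorem endsBelow_tight (hs : F.Separates) {j : ℕ} (hj : 1 ≤ j) : ∀ l x, 1 ≤ l → l + j = d →
    2 ^ l ≤ x → x < 2 ^ (l + 1) → 2 ^ (j + 1) ≤ F.endsBelow j x ∧
      (F.endsBelow j x = 2 ^ (j + 1) → (F.through x).card = 2 ∧ ∀ i, F.has i x →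
        ∃ s : Finset ℕ, j < s.card ∧ ∀ w ∈ s, x ≤ w ∧ w < 2 ^ (d + 1) ∧ F.has i w ∧
          (F.through w).card = 2) := by
  -- A member through the edge above `x` does not end at `x`, so it continues into a child; `x` is
  -- added to the edges collected there.
  have descend : ∀ j x, 2 ≤ x → x < 2 ^ d → F.ends x = 0 → (F.through x).card = 2 →
      (∀ y, y = 2 * x ∨ y = 2 * x + 1 → ∀ i, F.has i y →
        ∃ s : Finset ℕ, j < s.card ∧ ∀ w ∈ s, y ≤ w ∧ w < 2 ^ (d + 1) ∧ F.has i w ∧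
          (F.through w).card = 2) → ∀ i, F.has i x →
        ∃ s : Finset ℕ, j + 1 < s.card ∧ ∀ w ∈ s, x ≤ w ∧ w < 2 ^ (d + 1) ∧ F.has i w ∧
          (F.through w).card = 2 := by
    intro j x hx2 hx h0 hc hy i hi
    have hp : 2 ^ (d + 1) = 2 * 2 ^ d := pow_succ' 2 d
    obtain ⟨y, hyx, hiy⟩ : ∃ y, (y = 2 * x ∨ y = 2 * x + 1) ∧ F.has i y := by
      rcases F.end_up i x hx2 hx hi with h | h | h
      exacts [absurd h (F.not_end_of_ends_eq_zero h0 i), ⟨_, Or.inl rfl, h⟩, ⟨_, Or.inr rfl, h⟩]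
    obtain ⟨s, hs, hs'⟩ := hy y hyx i hiy
    have hxs : x ∉ s := fun h => by have := (hs' x h).1; omega
    refine ⟨insert x s, by rw [Finset.card_insert_of_notMem hxs]; omega, ?_⟩
    intro w hw
    rcases Finset.mem_insert.1 hw with rfl | hw
    · exact ⟨le_rfl, by omega, hi, hc⟩
    · obtain ⟨h1, h2⟩ := hs' w hw
      exact ⟨by omega, h2⟩
  induction j, hj using Nat.le_induction with
  | base =>
    intro l x hl hd hx hx'
    subst hd
    have hp : 2 ^ (l + 1) = 2 * 2 ^ l := pow_succ' 2 l
    have hp2 : 2 ^ (l + 1 + 1) = 2 * 2 ^ (l + 1) := pow_succ' 2 _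
    have h2 : 2 ^ 1 ≤ 2 ^ l := Nat.pow_le_pow_right (by norm_num) hl
    obtain ⟨h4, h5⟩ := F.height_one hs (x := x) (by omega) (by omega) (by omega)
    refine ⟨h4, fun h => ?_⟩
    obtain ⟨e0, e1, e2⟩ := h5 h
    have hc := F.card_through_eq_two hs (by omega) hx' e0 e1 e2
    refine ⟨hc, descend 0 x (by omega) (by omega) e0 hc ?_⟩
    intro y hy i hi
    refine ⟨{y}, by simp, ?_⟩
    intro w hw
    rw [Finset.mem_singleton] at hw
    subst hw
    refine ⟨le_rfl, by omega, hi, ?_⟩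
    rcases hy with rfl | rfl <;> assumption
  | succ j hj ih =>
    intro l x hl hd hx hx'
    have hp : 2 ^ (l + 1) = 2 * 2 ^ l := pow_succ' 2 l
    have hp2 : 2 ^ (l + 1 + 1) = 2 * 2 ^ (l + 1) := pow_succ' 2 _
    have hp3 : 2 ^ (j + 1 + 1) = 2 * 2 ^ (j + 1) := pow_succ' 2 _
    have h2 : 2 ^ 1 ≤ 2 ^ l := Nat.pow_le_pow_right (by norm_num) hl
    have hld : 2 ^ (l + 1) ≤ 2 ^ d := Nat.pow_le_pow_right (by norm_num) (by omega)
    obtain ⟨a1, a2⟩ := ih (l + 1) (2 * x) (by omega) (by omega) (by omega) (by omega)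
    obtain ⟨b1, b2⟩ := ih (l + 1) (2 * x + 1) (by omega) (by omega) (by omega) (by omega)
    simp only [endsBelow]
    refine ⟨by omega, fun h => ?_⟩
    obtain ⟨a3, a4⟩ := a2 (by omega)
    obtain ⟨b3, b4⟩ := b2 (by omega)
    have e0 : F.ends x = 0 := by omega
    have hc := F.card_through_eq_two hs (by omega) (by omega) e0 a3 b3
    refine ⟨hc, descend j x (by omega) (by omega) e0 hc ?_⟩
    rintro y (rfl | rfl)
    exacts [a4, b4]

/-- Pigeonhole: in the tight case a member `i` contains `k + 1` edges that each lie in one other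
member only. Two of these other members share a colour, while any separation of the two edges has to
use exactly them. -/
theorem endsBelow_rainbow {k : ℕ} (hk : 1 ≤ k) {c : ι → Fin k} (hc : F.RainbowSeparates c)
    {l x : ℕ} (hl : 1 ≤ l) (hd : l + k = d) (hx : 2 ^ l ≤ x) (hx' : x < 2 ^ (l + 1)) :
    2 ^ (k + 1) + 1 ≤ F.endsBelow k x := by
  obtain ⟨h1, h2⟩ := F.endsBelow_tight hc.separates hk l x hl hd hx hx'
  classical
  by_contra hlt
  obtain ⟨h3, h4⟩ := h2 (by omega)
  have hl2 : 2 ^ 1 ≤ 2 ^ l := Nat.pow_le_pow_right (by norm_num) hl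
  obtain ⟨i, hi⟩ : (F.through x).Nonempty := Finset.card_pos.1 (by omega)
  obtain ⟨s, hs, hs'⟩ := h4 i (F.mem_through.1 hi)
  -- `o` is the second member through `w`; off `s` its value is irrelevant.
  have other : ∀ w : ℕ, ∃ o, w ∈ s → ∀ a, F.has a w → a = i ∨ a = o := by
    intro w
    by_cases hw : w ∈ s
    · obtain ⟨-, -, hiw, hcw⟩ := hs' w hw
      obtain ⟨p, q, -, hpq⟩ := Finset.card_eq_two.1 hcw
      have hm : ∀ a, F.has a w ↔ a = p ∨ a = q := fun a => by
        rw [← mem_through, hpq]; simp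
      rcases (hm i).1 hiw with rfl | rfl
      · exact ⟨q, fun _ a ha => (hm a).1 ha⟩
      · exact ⟨p, fun _ a ha => ((hm a).1 ha).symm⟩
    · exact ⟨i, fun h => absurd h hw⟩
  choose o ho using other
  obtain ⟨w, hw, w', hw', hne, heq⟩ := Finset.exists_ne_map_eq_of_card_lt_of_maps_to
    (s := s) (t := Finset.univ) (f := fun w => c (o w)) (by simpa using hs) (by simp)
  obtain ⟨a1, a2, a3, -⟩ := hs' w hw
  obtain ⟨b1, b2, b3, -⟩ := hs' w' hw'
  obtain ⟨p, q, hpq, ⟨p1, p2⟩, q1, q2⟩ := hc w w' (by omega) a2 (by omega) b2 hne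
  have hp : p = o w := by
    rcases ho w hw p p1 with rfl | h
    exacts [absurd b3 p2, h]
  have hq : q = o w' := by
    rcases ho w' hw' q q1 with rfl | h
    exacts [absurd a3 q2, h]
  subst hp hq
  exact hpq heq

/-- A bound for all subtrees of height `j` doubles with each level above them. The bound is only
assumed for `1 ≤ l`, because nothing is known about ends at the root; `j < d` ensures that this
suffices. -/
theorem le_endsBelow_of_level {j b : ℕ}
    (h : ∀ l x, 1 ≤ l → l + j = d → 2 ^ l ≤ x → x < 2 ^ (l + 1) → b ≤ F.endsBelow j x) (t : ℕ) :
    ∀ l x, l + (j + t) = d → j < d → 2 ^ l ≤ x → x < 2 ^ (l + 1) →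
      2 ^ t * b ≤ F.endsBelow (j + t) x := by
  induction t with
  | zero => intro l x hd hj h1 h2; simpa using h l x (by omega) hd h1 h2
  | succ t ih =>
    intro l x hd hj h1 h2
    have hp : 2 ^ (l + 1) = 2 * 2 ^ l := pow_succ' 2 l
    have hp2 : 2 ^ (l + 1 + 1) = 2 * 2 ^ (l + 1) := pow_succ' 2 _
    have a := ih (l + 1) (2 * x) (by omega) hj (by omega) (by omega)
    have b := ih (l + 1) (2 * x + 1) (by omega) hj (by omega) (by omega)
    rw [← add_assoc, endsBelow, pow_succ]
    linarith

/-- A separating family has at least as many members as there are leaves. -/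
theorem two_pow_le_card (hs : F.Separates) (hd : 2 ≤ d) : 2 ^ d ≤ Fintype.card ι := by
  obtain ⟨t, rfl⟩ := Nat.exists_eq_add_of_le (show 1 ≤ d by omega)
  have h := F.le_endsBelow_of_level (j := 1) (b := 4)
    (fun l x h1 h2 h3 h4 => (F.endsBelow_tight hs le_rfl l x h1 h2 h3 h4).1) t 0 1 (by omega)
    (by omega) le_rfl (by norm_num)
  have := F.endsBelow_root_le
  rw [pow_add]
  omega

/-- A rainbow separating family has a proportion of members in excess of the number of leaves. -/
theorem rainbow_le_card {k : ℕ} (hk : 1 ≤ k) {c : ι → Fin k} (hc : F.RainbowSeparates c)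
    (t : ℕ) (hd : k + t = d) (ht : 1 ≤ t) : 2 ^ t * (2 ^ (k + 1) + 1) ≤ 2 * Fintype.card ι := by
  have h := F.le_endsBelow_of_level (j := k) (b := 2 ^ (k + 1) + 1)
    (fun l x h1 h2 h3 h4 => F.endsBelow_rainbow hk hc h1 h2 h3 h4) t 0 1 (by omega)
    (by omega) le_rfl (by norm_num)
  rw [hd] at h
  exact h.trans F.endsBelow_root_le

end HeapPathFamily

/-! ### Heap labellings of complete binary trees -/

/-- A labelling of the vertices of `G` by `1, …, 2 ^ (d + 1) - 1` under which the neighbours of a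
vertex are its half (rounded down) and its doubles `2 * x`, `2 * x + 1`. -/
structure HeapLabelling {V : Type*} (G : SimpleGraph V) (d : ℕ) where
  label : V → ℕ
  vert : ℕ → V
  label_pos : ∀ v, 1 ≤ label v
  label_lt : ∀ v, label v < 2 ^ (d + 1)
  vert_label : ∀ v, vert (label v) = v
  label_vert : ∀ m, 1 ≤ m → m < 2 ^ (d + 1) → label (vert m) = m
  adj_iff : ∀ u v, G.Adj u v ↔ label u = label v / 2 ∨ label v = label u / 2

namespace SimpleGraph

variable {V : Type*} {G : SimpleGraph V}

/-- Shortest walks from `r` through either vertex are paths to `v`, and a tree has only one such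
path. -/
theorem IsTree.parent_unique (hG : G.IsTree) {r v p q : V} (hp : G.Adj p v) (hq : G.Adj q v)
    (hp' : G.dist r v = G.dist r p + 1) (hq' : G.dist r v = G.dist r q + 1) : p = q := by
  obtain ⟨a, ha⟩ := hG.connected.exists_walk_length_eq_dist r p
  obtain ⟨b, hb⟩ := hG.connected.exists_walk_length_eq_dist r q
  have h1 : (a.concat hp).IsPath := Walk.isPath_of_length_eq_dist _ (by simp [ha, hp'])
  have h2 : (b.concat hq).IsPath := Walk.isPath_of_length_eq_dist _ (by simp [hb, hq'])
  have h3 := (hG.existsUnique_path r v).unique h1 h2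
  have := congrArg Walk.penultimate h3
  simpa using this

theorem Connected.exists_parent (hG : G.Connected) {r v : V} (hv : v ≠ r) :
    ∃ p, G.Adj p v ∧ G.dist r v = G.dist r p + 1 := by
  obtain ⟨a, ha⟩ := hG.exists_walk_length_eq_dist v r
  cases a with
  | nil => exact absurd rfl hv
  | @cons _ p _ h a =>
    refine ⟨p, h.symm, ?_⟩
    have h1 := G.dist_le a
    rw [Walk.length_cons, dist_comm] at ha
    rw [dist_comm] at h1
    have h2 := hG.dist_triangle (u := r) (v := p) (w := v)
    rw [dist_eq_one_iff_adj.2 h.symm] at h2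
    omega

end SimpleGraph

namespace RainbowSep

variable {V : Type*} {G : SimpleGraph V}

open Classical in
theorem ncard_children [Finite V] (hG : G.IsTree) (r v : V) :
    {u | G.Adj v u ∧ G.dist r u = G.dist r v + 1}.ncard + (if v = r then 0 else 1) = deg G v := by
  rw [deg]
  split_ifs with h
  · subst h
    rw [add_zero]
    congr 1
    ext u
    simp only [Set.mem_ofPred_eq, SimpleGraph.mem_neighborSet, SimpleGraph.dist_self, zero_add,
      SimpleGraph.dist_eq_one_iff_adj, and_self]
  · obtain ⟨p, hp, hp'⟩ := hG.connected.exists_parent h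
    rw [← Set.ncard_insert_of_notMem (a := p) (by simp; omega)]
    congr 1
    ext u
    simp only [Set.mem_insert_iff, Set.mem_ofPred_eq, SimpleGraph.mem_neighborSet]
    constructor
    · rintro (rfl | h)
      exacts [hp.symm, h.1]
    · intro hu
      rcases hG.dist_eq_dist_add_one_of_adj r hu with h' | h'
      · exact Or.inl (hG.parent_unique hu.symm hp h' hp')
      · exact Or.inr ⟨hu, h'⟩

/-- The vertex with heap label `m`, when `c` lists the children. -/
def heapVertex (r : V) (c : Bool → V → V) (m : ℕ) : V :=
  if h : m ≤ 1 then r else c (m % 2 == 1) (heapVertex r c (m / 2))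
termination_by m
decreasing_by omega

/-- The degree conditions give every vertex at distance less than `d` from the root exactly two
children. Ordering them arbitrarily and following the binary digits of a label from the root gives
the labelling; it is injective because parents are unique and onto because every non-root vertex has
a parent. -/
theorem IsCompleteBinaryTree.exists_heapLabelling [Finite V] [Nontrivial V]
    (hG : IsCompleteBinaryTree G) : ∃ d, Nonempty (HeapLabelling G d) := by
  classical
  obtain ⟨hT, r, hr, hdeg, d, hd⟩ := hG
  have hch := ncard_children hT r
  obtain ⟨x, hx⟩ := Finite.exists_max (fun v => G.dist r v)
  have hdr : deg G r = 2 := by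
    refine hr.resolve_left fun h0 => ?_
    obtain ⟨y, hy⟩ := hT.connected.preconnected.exists_adj_of_nontrivial r
    rw [deg, Set.ncard_eq_zero] at h0
    exact (Set.eq_empty_iff_forall_notMem.1 h0) y hy
  -- A vertex farthest from the root has no children, so it is a leaf; hence `d` is the largest
  -- distance from the root.
  have top : ∀ v, G.dist r v = G.dist r x → v ≠ r ∧ deg G v = 1 := by
    intro v hv
    have h0 : {u | G.Adj v u ∧ G.dist r u = G.dist r v + 1} = ∅ := by
      ext u
      have := hx u
      simp only [Set.mem_ofPred_eq, Set.mem_empty_iff_false, iff_false, not_and]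
      omega
    have := hch v
    rw [h0, Set.ncard_empty] at this
    split_ifs at this with h
    · subst h; omega
    · exact ⟨h, by omega⟩
  have hdx : G.dist r x = d := hd x (top x rfl).2
  have hle : ∀ v, G.dist r v ≤ d := fun v => hdx ▸ hx v
  have hex : ∀ v, ∃ a b, G.dist r v < d → a ≠ b ∧
      ∀ u, (G.Adj v u ∧ G.dist r u = G.dist r v + 1) ↔ u = a ∨ u = b := by
    intro v
    by_cases hv : G.dist r v < d
    · have h2 : {u | G.Adj v u ∧ G.dist r u = G.dist r v + 1}.ncard = 2 := by
        have := hch v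
        split_ifs at this with h
        · subst h; omega
        · rcases hdeg v h with h1 | h1
          · have := hd v h1; omega
          · omega
      obtain ⟨a, b, hab, h⟩ := Set.ncard_eq_two.1 h2
      exact ⟨a, b, fun _ => ⟨hab, fun u => by
        have := Set.ext_iff.1 h u
        simpa using this⟩⟩
    · exact ⟨v, v, fun h => absurd h hv⟩
  choose a b hab using hex
  set c : Bool → V → V := fun t => if t then b else a with hc
  set ψ := heapVertex r c with hψ
  have ψ1 : ψ 1 = r := by rw [hψ, heapVertex]; simp
  have ψs : ∀ m, 2 ≤ m → ψ m = c (m % 2 == 1) (ψ (m / 2)) := by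
    intro m hm
    rw [hψ, heapVertex, dif_neg (by omega)]
  have cadj : ∀ t v, G.dist r v < d → G.Adj v (c t v) ∧ G.dist r (c t v) = G.dist r v + 1 := by
    intro t v hv
    refine ((hab v hv).2 _).2 ?_
    cases t <;> simp [hc]
  have cinj : ∀ t t' v, G.dist r v < d → c t v = c t' v → t = t' := by
    intro t t' v hv h
    have h1 := (hab v hv).1
    cases t <;> cases t' <;> simp only [hc, if_true, Bool.false_eq_true, if_false] at h ⊢
    exacts [absurd h h1, absurd h.symm h1]
  have hdist : ∀ l m, l ≤ d → 2 ^ l ≤ m → m < 2 ^ (l + 1) → G.dist r (ψ m) = l := by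
    intro l
    induction l with
    | zero =>
      intro m _ h1 h2
      have : m = 1 := by simp at h1 h2; omega
      rw [this, ψ1, SimpleGraph.dist_self]
    | succ l ih =>
      intro m hl h1 h2
      have hp : 2 ^ (l + 1) = 2 * 2 ^ l := pow_succ' 2 l
      have hp2 : 2 ^ (l + 1 + 1) = 2 * 2 ^ (l + 1) := pow_succ' 2 _
      have hpos := Nat.one_le_two_pow (n := l)
      have h3 := ih (m / 2) (by omega) (by omega) (by omega)
      rw [ψs m (by omega), (cadj _ _ (by omega)).2, h3]
  have hlog : ∀ m, 1 ≤ m → m < 2 ^ (d + 1) → G.dist r (ψ m) = Nat.log 2 m ∧ Nat.log 2 m ≤ d := by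
    intro m h1 h2
    have h3 : Nat.log 2 m < d + 1 := Nat.log_lt_of_lt_pow (by omega) h2
    exact ⟨hdist _ m (by omega) (Nat.pow_log_le_self 2 (by omega))
      (Nat.lt_pow_succ_log_self (by norm_num) m), by omega⟩
  have hpar : ∀ m, 2 ≤ m → m < 2 ^ (d + 1) →
      G.Adj (ψ (m / 2)) (ψ m) ∧ G.dist r (ψ m) = G.dist r (ψ (m / 2)) + 1 ∧
        G.dist r (ψ (m / 2)) < d := by
    intro m h1 h2
    obtain ⟨h3, h4⟩ := hlog m (by omega) h2
    obtain ⟨h5, h6⟩ := hlog (m / 2) (by omega) (by omega)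
    have h7 : Nat.log 2 m = Nat.log 2 (m / 2) + 1 := Nat.log_of_one_lt_of_le (by norm_num) h1
    have h8 := cadj (m % 2 == 1) (ψ (m / 2)) (by omega)
    rw [← ψs m h1] at h8
    exact ⟨h8.1, h8.2, by omega⟩
  have hinj : ∀ m m', 1 ≤ m → m < 2 ^ (d + 1) → 1 ≤ m' → m' < 2 ^ (d + 1) → ψ m = ψ m' →
      m = m' := by
    intro m
    induction m using Nat.strong_induction_on with
    | _ m ih =>
      intro m' h1 h2 h3 h4 he
      have hl : Nat.log 2 m = Nat.log 2 m' := by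
        rw [← (hlog m h1 h2).1, ← (hlog m' h3 h4).1, he]
      by_cases hm : m = 1
      · subst hm
        have : m' < 2 := (Nat.log_eq_zero_iff.1 (by rw [← hl]; simp)).resolve_right (by simp)
        omega
      by_cases hm' : m' = 1
      · subst hm'
        have : m < 2 := (Nat.log_eq_zero_iff.1 (by rw [hl]; simp)).resolve_right (by simp)
        omega
      obtain ⟨a1, a2, a3⟩ := hpar m (by omega) h2
      obtain ⟨b1, b2, b3⟩ := hpar m' (by omega) h4
      have hq : ψ (m / 2) = ψ (m' / 2) :=
        hT.parent_unique (r := r) a1 (he ▸ b1) a2 (by rw [he]; exact b2)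
      have h5 := ih (m / 2) (by omega) (m' / 2) (by omega) (by omega) (by omega) (by omega) hq
      rw [ψs m (by omega), ψs m' (by omega), ← hq] at he
      have h6 := cinj _ _ _ a3 he
      have h7 : m % 2 = 1 ↔ m' % 2 = 1 := by
        rw [← beq_iff_eq, ← beq_iff_eq (a := m' % 2), h6]
      omega
  have hsurj : ∀ l v, G.dist r v = l → ∃ m, 1 ≤ m ∧ m < 2 ^ (l + 1) ∧ ψ m = v := by
    intro l
    induction l with
    | zero =>
      intro v hv
      rw [hT.connected.dist_eq_zero_iff] at hv
      exact ⟨1, le_rfl, by norm_num, hv ▸ ψ1⟩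
    | succ l ih =>
      intro v hv
      have hvr : v ≠ r := by rintro rfl; simp at hv
      obtain ⟨p, hp, hp'⟩ := hT.connected.exists_parent hvr
      obtain ⟨m, h1, h2, rfl⟩ := ih p (by omega)
      have hlt : G.dist r (ψ m) < d := by have := hle v; omega
      have hp2 : 2 ^ (l + 1 + 1) = 2 * 2 ^ (l + 1) := pow_succ' 2 _
      rcases ((hab _ hlt).2 v).1 ⟨hp, hp'⟩ with h | h
      · refine ⟨2 * m, by omega, by omega, ?_⟩
        rw [ψs _ (by omega), h]
        simp [hc]
      · refine ⟨2 * m + 1, by omega, by omega, ?_⟩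
        rw [ψs _ (by omega), h]
        have e1 : (2 * m + 1) / 2 = m := by omega
        have e2 : (2 * m + 1) % 2 = 1 := by omega
        simp [hc, e1, e2]
  have hsurj' : ∀ v, ∃ m, 1 ≤ m ∧ m < 2 ^ (d + 1) ∧ ψ m = v := by
    intro v
    obtain ⟨m, h1, h2, h3⟩ := hsurj _ v rfl
    exact ⟨m, h1, h2.trans_le (Nat.pow_le_pow_right (by norm_num) (by have := hle v; omega)), h3⟩
  choose φ hφ1 hφ2 hφ3 using hsurj'
  have half : ∀ u v, G.Adj u v → G.dist r v = G.dist r u + 1 → φ u = φ v / 2 := by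
    intro u v huv h
    have hv2 : 2 ≤ φ v := by
      by_contra hlt
      have := hφ1 v
      have h1 : φ v = 1 := by omega
      have h3 := hφ3 v
      rw [h1, ψ1] at h3
      rw [← h3, SimpleGraph.dist_self] at h
      omega
    obtain ⟨a1, a2, a3⟩ := hpar (φ v) hv2 (hφ2 v)
    rw [hφ3 v] at a1 a2
    have := hT.parent_unique (r := r) huv a1 h a2
    refine hinj _ _ (hφ1 u) (hφ2 u) (by omega) (by have := hφ2 v; omega) ?_
    rw [hφ3 u, this]
  have half' : ∀ u v, φ u = φ v / 2 → G.Adj u v := by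
    intro u v h
    have := hφ1 u
    have h1 := (hpar (φ v) (by omega) (hφ2 v)).1
    rwa [← h, hφ3, hφ3] at h1
  refine ⟨d, ⟨⟨φ, ψ, hφ1, hφ2, hφ3, fun m h1 h2 => hinj _ _ (hφ1 _) (hφ2 _) h1 h2 (hφ3 _), ?_⟩⟩⟩
  intro u v
  constructor
  · intro huv
    rcases hT.dist_eq_dist_add_one_of_adj r huv with h | h
    · exact Or.inr (half v u huv.symm h)
    · exact Or.inl (half u v huv h)
  · rintro (h | h)
    exacts [half' u v h, (half' v u h).symm]

end RainbowSep

/-! ### Descendants in the heap, and edges as cuts -/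

/-- `x` is `w` or a descendant of `w` in the heap order. -/
def HeapDesc (w x : ℕ) : Prop := ∃ j, x / 2 ^ j = w

namespace HeapDesc

theorem iff_eq_or_half {w x : ℕ} : HeapDesc w x ↔ x = w ∨ HeapDesc w (x / 2) := by
  constructor
  · rintro ⟨j, hj⟩
    cases j with
    | zero => left; simpa using hj
    | succ j => right; exact ⟨j, by rw [Nat.div_div_eq_div_mul, ← pow_succ']; exact hj⟩
  · rintro (rfl | ⟨j, hj⟩)
    · exact ⟨0, by simp⟩
    · exact ⟨j + 1, by rw [pow_succ', ← Nat.div_div_eq_div_mul]; exact hj⟩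

theorem le {w x : ℕ} (h : HeapDesc w x) : w ≤ x := by
  obtain ⟨j, rfl⟩ := h
  exact Nat.div_le_self _ _

theorem self (w : ℕ) : HeapDesc w w := ⟨0, by simp⟩

theorem iff_half_of_ne {w x : ℕ} (h : x ≠ w) : HeapDesc w x ↔ HeapDesc w (x / 2) := by
  rw [iff_eq_or_half]
  simp [h]

theorem not_half {w : ℕ} (h : 1 ≤ w) : ¬ HeapDesc w (w / 2) := fun h' => by
  have := h'.le
  omega

/-- The levels of `w` and `x` force the number of halvings to be `t`; so the descendants of `w` on a
given level are consecutive. -/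
theorem iff_interval {w x e l t : ℕ} (hx : 2 ^ e ≤ x) (hx' : x < 2 ^ (e + 1)) (hw : 2 ^ l ≤ w)
    (hw' : w < 2 ^ (l + 1)) (ht : l + t = e) :
    HeapDesc w x ↔ w * 2 ^ t ≤ x ∧ x < w * 2 ^ t + 2 ^ t := by
  have key : ∀ j, x / 2 ^ j = w ↔ w * 2 ^ j ≤ x ∧ x < w * 2 ^ j + 2 ^ j := by
    intro j
    rw [Nat.div_eq_iff (by positivity)]
    have : 0 < 2 ^ j := by positivity
    omega
  constructor
  · rintro ⟨j, hj⟩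
    have h := (key j).1 hj
    have h1 : 2 ^ (l + j) < 2 ^ (e + 1) := by
      rw [pow_add]
      exact ((Nat.mul_le_mul_right _ hw).trans h.1).trans_lt hx'
    have h2 : 2 ^ e < 2 ^ (l + 1 + j) := by
      rw [pow_add _ (l + 1)]
      refine (hx.trans_lt h.2).trans_le ?_
      rw [← Nat.succ_mul]
      exact Nat.mul_le_mul_right _ hw'
    have h1 := (Nat.pow_lt_pow_iff_right (by norm_num)).1 h1
    have h2 := (Nat.pow_lt_pow_iff_right (by norm_num)).1 h2
    obtain rfl : j = t := by omega
    exact h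
  · intro h
    exact ⟨t, (key t).2 h⟩

end HeapDesc

namespace SimpleGraph.Walk

variable {V : Type*} {G : SimpleGraph V}

open Classical in
/-- If `e` is the only edge between `D` and its complement, then a walk passes through `e` an odd
number of times iff it has one end in `D`. -/
theorem odd_count_iff_of_cut {e : Sym2 V} {D : V → Prop}
    (he : ∀ u v, G.Adj u v → (s(u, v) = e ↔ ¬ (D u ↔ D v))) {u v : V} (p : G.Walk u v) :
    Odd (p.edges.count e) ↔ ¬ (D u ↔ D v) := by
  induction p with
  | nil => simp
  | @cons u v w h p ih =>
    have := he u v h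
    rw [edges_cons, List.count_cons]
    by_cases hh : s(u, v) = e
    · simp only [hh, beq_self_eq_true, if_true, Nat.odd_add_one, ih]
      tauto
    · simp only [beq_iff_eq, hh, if_false, add_zero, ih]
      tauto

/-- A trail uses `e` at most once, so an odd count means membership. -/
theorem IsTrail.mem_edges_iff_of_cut {e : Sym2 V} {D : V → Prop}
    (he : ∀ u v, G.Adj u v → (s(u, v) = e ↔ ¬ (D u ↔ D v))) {u v : V} {p : G.Walk u v}
    (hp : p.IsTrail) : e ∈ p.edges ↔ ¬ (D u ↔ D v) := by
  classical
  rw [← odd_count_iff_of_cut he p]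
  constructor
  · intro h
    rw [List.count_eq_one_of_mem hp.edges_nodup h]
    exact odd_one
  · intro h
    exact List.count_pos_iff.1 h.pos

/-- A path leaves an inner vertex by another edge. -/
theorem IsTrail.exists_other_edge {u v x : V} {p : G.Walk u v} (hp : p.IsTrail) (hu : x ≠ u)
    (hv : x ≠ v) {e : Sym2 V} (he : e ∈ p.edges) (hx : x ∈ e) :
    ∃ e' ∈ p.edges, e' ≠ e ∧ x ∈ e' := by
  classical
  -- A trail has an even number of edges at a vertex that is not one of its ends, so it cannot have
  -- just one.
  have h := (hp.even_countP_edges_iff x).2 fun _ => ⟨hu, hv⟩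
  rw [List.countP_eq_length_filter] at h
  set l := p.edges.filter (fun e => decide (x ∈ e)) with hl
  have hel : e ∈ l := by simp [hl, he, hx]
  have hnd : l.Nodup := hp.edges_nodup.filter _
  by_contra! hc
  have hall : ∀ e' ∈ l, e' = e := by
    intro e' he'
    simp only [hl, List.mem_filter, decide_eq_true_eq] at he'
    by_contra hne
    exact hc e' he'.1 hne he'.2
  have h1 : l = List.replicate l.length e := List.eq_replicate_of_mem hall
  have h2 : l.length ≤ 1 := by
    rw [h1] at hnd
    exact List.nodup_replicate.1 hnd
  have h3 : 0 < l.length := List.length_pos_of_mem hel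
  rw [show l.length = 1 by omega] at h
  exact absurd h (by decide)

end SimpleGraph.Walk

/-! ### Paths of the tree in terms of labels -/

namespace HeapLabelling

variable {V : Type*} {G : SimpleGraph V} {d : ℕ} (H : HeapLabelling G d)

/-- The edge between the vertex labelled `w` and its parent. -/
def edge (w : ℕ) : Sym2 V := s(H.vert w, H.vert (w / 2))

theorem vert_eq_iff {v : V} {m : ℕ} (h1 : 1 ≤ m) (h2 : m < 2 ^ (d + 1)) :
    v = H.vert m ↔ H.label v = m := by
  constructor
  · rintro rfl; exact H.label_vert m h1 h2
  · rintro rfl; exact (H.vert_label v).symm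

theorem mem_edge_iff {v : V} {w : ℕ} (h1 : 2 ≤ w) (h2 : w < 2 ^ (d + 1)) :
    v ∈ H.edge w ↔ w = H.label v ∨ w / 2 = H.label v := by
  rw [edge, Sym2.mem_iff, H.vert_eq_iff (by omega) h2, H.vert_eq_iff (by omega) (by omega)]
  tauto

theorem edge_mem {w : ℕ} (h1 : 2 ≤ w) (h2 : w < 2 ^ (d + 1)) : H.edge w ∈ G.edgeSet := by
  rw [edge, SimpleGraph.mem_edgeSet, H.adj_iff, H.label_vert w (by omega) h2,
    H.label_vert (w / 2) (by omega) (by omega)]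
  simp

theorem exists_edge {e : Sym2 V} (he : e ∈ G.edgeSet) :
    ∃ w, 2 ≤ w ∧ w < 2 ^ (d + 1) ∧ e = H.edge w := by
  induction e with
  | _ u v =>
    rw [SimpleGraph.mem_edgeSet, H.adj_iff] at he
    have hu := H.label_pos u
    have hv := H.label_pos v
    rcases he with h | h
    · refine ⟨H.label v, by omega, H.label_lt v, ?_⟩
      rw [edge, ← h, H.vert_label, H.vert_label, Sym2.eq_swap]
    · refine ⟨H.label u, by omega, H.label_lt u, ?_⟩
      rw [edge, ← h, H.vert_label, H.vert_label]

theorem edge_injective {w w' : ℕ} (h1 : 2 ≤ w) (h2 : w < 2 ^ (d + 1)) (h1' : 2 ≤ w')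
    (h2' : w' < 2 ^ (d + 1)) (h : H.edge w = H.edge w') : w = w' := by
  have a : H.vert w ∈ H.edge w' := by rw [← h]; simp [edge]
  have b : H.vert w' ∈ H.edge w := by rw [h]; simp [edge]
  rw [H.mem_edge_iff h1' h2', H.label_vert w (by omega) h2] at a
  rw [H.mem_edge_iff h1 h2, H.label_vert w' (by omega) h2'] at b
  omega

/-- Passing from a label to its half changes descent from `w` only at `w` itself. -/
theorem cut_edge {w : ℕ} (h1 : 2 ≤ w) (h2 : w < 2 ^ (d + 1)) (u v : V) (h : G.Adj u v) :
    s(u, v) = H.edge w ↔ ¬ (HeapDesc w (H.label u) ↔ HeapDesc w (H.label v)) := by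
  have main : ∀ u v : V, H.label u = H.label v / 2 →
      (s(u, v) = H.edge w ↔ ¬ (HeapDesc w (H.label u) ↔ HeapDesc w (H.label v))) := by
    intro u v huv
    have hu := H.label_pos u
    have e : s(u, v) = H.edge (H.label v) := by
      rw [edge, ← huv, H.vert_label, H.vert_label, Sym2.eq_swap]
    rw [e]
    by_cases hw : H.label v = w
    · have := HeapDesc.not_half (w := w) (by omega)
      have := HeapDesc.self w
      rw [huv, hw]
      tauto
    · have h3 := HeapDesc.iff_half_of_ne hw
      rw [huv, ← h3]
      simp only [iff_self, not_true_eq_false, iff_false]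
      exact fun h => hw (H.edge_injective (by omega) (H.label_lt v) h1 h2 h)
  rcases (H.adj_iff u v).1 h with h | h
  · exact main u v h
  · rw [Sym2.eq_swap, main v u h, iff_comm (a := HeapDesc w (H.label v))]

theorem connected {V : Type*} {G : SimpleGraph V} {d : ℕ} (H : HeapLabelling G d) :
    G.Connected := by
  have key : ∀ m, 1 ≤ m → m < 2 ^ (d + 1) → G.Reachable (H.vert 1) (H.vert m) := by
    intro m
    induction m using Nat.strong_induction_on with
    | _ m ih =>
      intro h1 h2
      by_cases hm : m = 1
      · subst hm; rfl
      · refine (ih (m / 2) (by omega) (by omega) (by omega)).trans ?_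
        have := H.edge_mem (w := m) (by omega) h2
        rw [edge, SimpleGraph.mem_edgeSet] at this
        exact this.symm.reachable
  have : Nonempty V := ⟨H.vert 1⟩
  refine ⟨fun u v => ?_⟩
  have hu := key _ (H.label_pos u) (H.label_lt u)
  have hv := key _ (H.label_pos v) (H.label_lt v)
  rw [H.vert_label] at hu hv
  exact hu.symm.trans hv

theorem card_eq {V : Type*} {G : SimpleGraph V} {d : ℕ} (H : HeapLabelling G d) [Fintype V] :
    Fintype.card V = 2 ^ (d + 1) - 1 := by
  classical
  have : Finset.univ.image H.label = Finset.Ico 1 (2 ^ (d + 1)) := by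
    ext m
    simp only [Finset.mem_image, Finset.mem_univ, true_and, Finset.mem_Ico]
    constructor
    · rintro ⟨v, rfl⟩; exact ⟨H.label_pos v, H.label_lt v⟩
    · rintro ⟨h1, h2⟩; exact ⟨H.vert m, H.label_vert m h1 h2⟩
  have hinj : Function.Injective H.label := fun u v h => by
    rw [← H.vert_label u, h, H.vert_label]
  rw [← Finset.card_univ, ← Finset.card_image_of_injective _ hinj, this, Nat.card_Ico]

theorem exists_path_between (u v : V) : ∃ P : GraphPath G, ∀ w, 2 ≤ w → w < 2 ^ (d + 1) →
    (H.edge w ∈ P.edges ↔ ¬ (HeapDesc w (H.label u) ↔ HeapDesc w (H.label v))) := by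
  obtain ⟨p, hp⟩ := H.connected.exists_isPath u v
  refine ⟨⟨p.toSubgraph, u, v, p, hp, rfl⟩, fun w h1 h2 => ?_⟩
  change H.edge w ∈ p.toSubgraph.edgeSet ↔ _
  rw [SimpleGraph.Walk.mem_edges_toSubgraph]
  exact hp.isTrail.mem_edges_iff_of_cut (D := fun x => HeapDesc w (H.label x)) (H.cut_edge h1 h2)

/-- The trace of a family of paths on the labels. -/
theorem exists_heapPathFamily {ι : Type*} (P : ι → GraphPath G) :
    ∃ F : HeapPathFamily d ι, ∀ i w, F.has i w ↔
      (2 ≤ w ∧ w < 2 ^ (d + 1)) ∧ H.edge w ∈ (P i).edges := by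
  choose u v p hp hP using fun i => (P i).2
  have step : ∀ i x w, (2 ≤ w ∧ w < 2 ^ (d + 1)) ∧ H.edge w ∈ (P i).edges → 1 ≤ x →
      x < 2 ^ (d + 1) → (w = x ∨ w / 2 = x) → (H.label (u i) = x ∨ H.label (v i) = x) ∨
      ∃ w', ((2 ≤ w' ∧ w' < 2 ^ (d + 1)) ∧ H.edge w' ∈ (P i).edges) ∧ w' ≠ w ∧
        (w' = x ∨ w' / 2 = x) := by
    rintro i x w ⟨⟨h1, h2⟩, hw⟩ hx hx' hwx
    rw [or_iff_not_imp_left]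
    intro hne
    push Not at hne
    have hl := H.label_vert x hx hx'
    rw [GraphPath.edges, hP, SimpleGraph.Walk.mem_edges_toSubgraph] at hw
    obtain ⟨e', he', hne', hxe'⟩ := (hp i).isTrail.exists_other_edge (x := H.vert x)
      (fun h => hne.1 (by rw [← h, hl])) (fun h => hne.2 (by rw [← h, hl])) hw
      ((H.mem_edge_iff h1 h2).2 (by rw [hl]; exact hwx))
    obtain ⟨w', a1, a2, rfl⟩ := H.exists_edge ((p i).edges_subset_edgeSet he')
    refine ⟨w', ⟨⟨a1, a2⟩, ?_⟩, fun h => hne' (by rw [h]), ?_⟩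
    · rw [GraphPath.edges, hP, SimpleGraph.Walk.mem_edges_toSubgraph]
      exact he'
    · rw [H.mem_edge_iff a1 a2, hl] at hxe'
      exact hxe'
  have hp2 : 2 ^ (d + 1) = 2 * 2 ^ d := pow_succ' 2 d
  have split : ∀ x w' : ℕ, (w' = x ∨ w' / 2 = x) → w' = x ∨ w' = 2 * x ∨ w' = 2 * x + 1 := by
    intro x w' h
    omega
  refine ⟨⟨fun i => H.label (u i), fun i => H.label (v i),
    fun i w => (2 ≤ w ∧ w < 2 ^ (d + 1)) ∧ H.edge w ∈ (P i).edges, ?_, ?_, ?_, ?_⟩,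
    fun i w => Iff.rfl⟩
  · intro i x h1 h2 h
    rcases step i x x h (by omega) h2 (Or.inl rfl) with h | ⟨w', a, b, c⟩
    · exact h
    · omega
  · intro i x h1 h2 h
    rcases step i x x h (by omega) (by omega) (Or.inl rfl) with h | ⟨w', a, b, c⟩
    · exact Or.inl h
    · rcases split _ _ c with rfl | rfl | rfl
      exacts [absurd rfl b, Or.inr (Or.inl a), Or.inr (Or.inr a)]
  · intro i x h1 h2 h
    rcases step i x (2 * x) h (by omega) (by omega) (by omega) with h | ⟨w', a, b, c⟩
    · exact Or.inl h
    · rcases split _ _ c with rfl | rfl | rfl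
      exacts [Or.inr (Or.inr a), absurd rfl b, Or.inr (Or.inl a)]
  · intro i x h1 h2 h
    rcases step i x (2 * x + 1) h (by omega) (by omega) (by omega) with h | ⟨w', a, b, c⟩
    · exact Or.inl h
    · rcases split _ _ c with rfl | rfl | rfl
      exacts [Or.inr (Or.inr a), Or.inr (Or.inl a), absurd rfl b]

theorem two_pow_le_card_of_isStronglySeparating {V : Type*} {G : SimpleGraph V} {d : ℕ}
    (H : HeapLabelling G d) (hd : 2 ≤ d) {S : Finset (GraphPath G)}
    (hS : IsStronglySeparating S) : 2 ^ d ≤ S.card := by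
  obtain ⟨F, hF⟩ := H.exists_heapPathFamily (fun i : S => i.1)
  have := F.two_pow_le_card (fun w w' h1 h2 h3 h4 hne => by
    obtain ⟨P, hP, a, b⟩ := hS _ (H.edge_mem h1 h2) _ (H.edge_mem h3 h4)
      (fun h => hne (H.edge_injective h1 h2 h3 h4 h))
    exact ⟨⟨P, hP⟩, by rw [hF]; exact ⟨⟨h1, h2⟩, a⟩, by rw [hF]; exact fun h => b h.2⟩) hd
  simpa using this

theorem rainbow_le_card_of_isRSPS {V : Type*} {G : SimpleGraph V} {d : ℕ}
    (H : HeapLabelling G d) {k : ℕ} (hk : 1 ≤ k) {t : ℕ} (hd : k + t = d) (ht : 1 ≤ t)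
    {S : Multiset (GraphPath G)} (hS : IsRSPS k S) :
    2 ^ t * (2 ^ (k + 1) + 1) ≤ 2 * S.card := by
  obtain ⟨C, rfl, hC⟩ := hS
  -- Positions in a list serve as indices, so that repeated paths count with their multiplicity and
  -- keep their own colours.
  obtain ⟨C, rfl⟩ := Quot.exists_rep C
  obtain ⟨F, hF⟩ := H.exists_heapPathFamily (fun i : Fin C.length => (C.get i).1)
  have := F.rainbow_le_card hk (c := fun i => (C.get i).2)
    (fun w w' h1 h2 h3 h4 hne => by
      obtain ⟨P, hP, Q, hQ, hPQ, ⟨a, b⟩, a', b'⟩ := hC _ (H.edge_mem h1 h2) _ (H.edge_mem h3 h4)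
        (fun h => hne (H.edge_injective h1 h2 h3 h4 h))
      obtain ⟨i, rfl⟩ := List.get_of_mem (Multiset.mem_coe.1 hP)
      obtain ⟨j, rfl⟩ := List.get_of_mem (Multiset.mem_coe.1 hQ)
      simp only [hF]
      exact ⟨i, j, hPQ, ⟨⟨⟨h1, h2⟩, a⟩, fun h => b h.2⟩, ⟨⟨h3, h4⟩, a'⟩, fun h => b' h.2⟩)
    t hd ht
  simpa using this

end HeapLabelling

/-! ### Gap paths: the construction for the upper bound -/

/-- The ends of the `g`-th gap path in the subtree of height `h` rooted at `R`: it joins the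
leaves on the two sides of the `g`-th gap between leaves, with the root in place of a leaf missing
at the border. -/
def gapLeft (h R g : ℕ) : ℕ := if g = 0 then R else R * 2 ^ h + g - 1

/-- The other end of the `g`-th gap path. -/
def gapRight (h R g : ℕ) : ℕ := if g < 2 ^ h then R * 2 ^ h + g else R

/-- The labels of the edges on the path between `x` and `y`. -/
def OnHeapPath (x y w : ℕ) : Prop := ¬ (HeapDesc w x ↔ HeapDesc w y)

theorem onHeapPath_half {w v : ℕ} (hv : 1 ≤ v) : OnHeapPath v (v / 2) w ↔ w = v := by
  unfold OnHeapPath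
  by_cases h : v = w
  · subst h
    have := HeapDesc.not_half hv
    have := HeapDesc.self v
    tauto
  · have := HeapDesc.iff_half_of_ne h
    simp [this, Ne.symm h]

theorem subtree_bounds {q h R : ℕ} (h1 : 2 ^ q ≤ R) (h2 : R < 2 ^ (q + 1)) :
    2 ^ (q + h) ≤ R * 2 ^ h ∧ R * 2 ^ h + 2 ^ h ≤ 2 ^ (q + h + 1) := by
  constructor
  · rw [pow_add]; exact Nat.mul_le_mul_right _ h1
  · rw [add_right_comm, pow_add, ← Nat.succ_mul]; exact Nat.mul_le_mul_right _ h2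

theorem gap_bounds {q h R g : ℕ} (h1 : 2 ^ q ≤ R) (h2 : R < 2 ^ (q + 1)) (hg : g ≤ 2 ^ h) :
    (1 ≤ gapLeft h R g ∧ gapLeft h R g < 2 ^ (q + h + 1)) ∧
      (1 ≤ gapRight h R g ∧ gapRight h R g < 2 ^ (q + h + 1)) := by
  obtain ⟨h3, h4⟩ := subtree_bounds (h := h) h1 h2
  have h5 : 2 ^ (q + 1) ≤ 2 ^ (q + h + 1) := Nat.pow_le_pow_right (by norm_num) (by omega)
  have h6 : 1 ≤ 2 ^ q := Nat.one_le_two_pow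
  have h7 : 1 ≤ 2 ^ (q + h) := Nat.one_le_two_pow
  unfold gapLeft gapRight
  split_ifs <;> omega

/-- Both ends of a gap path lie in the subtree of `R`, hence on the same side of any edge not
strictly below `R`. -/
theorem not_onHeapPath_gap_of_top {q h R g w : ℕ} (h1 : 2 ^ q ≤ R) (h2 : R < 2 ^ (q + 1))
    (hg : g ≤ 2 ^ h) (hw : w < 2 ^ (q + 1)) :
    ¬ OnHeapPath (gapLeft h R g) (gapRight h R g) w := by
  have key : ∀ x, R * 2 ^ h ≤ x → x < R * 2 ^ h + 2 ^ h → (HeapDesc w x ↔ HeapDesc w R) := by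
    intro x hx hx'
    have hR : x / 2 ^ h = R := by
      rw [Nat.div_eq_iff (by positivity)]
      omega
    constructor
    · rintro ⟨j, rfl⟩
      have hj : h ≤ j := by
        by_contra hlt
        obtain ⟨e, rfl⟩ := Nat.exists_eq_add_of_lt (not_le.1 hlt)
        have : 2 ^ (q + 1) ≤ x / 2 ^ j := by
          rw [Nat.le_div_iff_mul_le (by positivity), ← pow_add]
          refine le_trans ?_ ((subtree_bounds (h := j + e + 1) h1 h2).1.trans hx)
          exact Nat.pow_le_pow_right (by norm_num) (by omega)
        omega
      obtain ⟨e, rfl⟩ := Nat.exists_eq_add_of_le hj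
      exact ⟨e, by rw [pow_add, ← Nat.div_div_eq_div_mul, hR]⟩
    · rintro ⟨j, rfl⟩
      exact ⟨h + j, by rw [pow_add, ← Nat.div_div_eq_div_mul, hR]⟩
  have hpos : 0 < 2 ^ h := by positivity
  have a : HeapDesc w (gapLeft h R g) ↔ HeapDesc w R := by
    unfold gapLeft
    split_ifs with h0
    · rfl
    · exact key _ (by omega) (by omega)
  have b : HeapDesc w (gapRight h R g) ↔ HeapDesc w R := by
    unfold gapRight
    split_ifs with h0
    · exact key _ (by omega) (by omega)
    · rfl
  rw [OnHeapPath, a, b]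
  simp

/-- An edge below level `q` lies in exactly two gap paths, and it is determined by them. -/
theorem exists_gaps {q h w : ℕ} (hw : 2 ^ (q + 1) ≤ w) (hw' : w < 2 ^ (q + h + 1)) :
    ∃ R a t, 2 ^ q ≤ R ∧ R < 2 ^ (q + 1) ∧ a + 2 ^ t ≤ 2 ^ h ∧ w * 2 ^ t = R * 2 ^ h + a ∧
      (∀ g ≤ 2 ^ h, OnHeapPath (gapLeft h R g) (gapRight h R g) w ↔ g = a ∨ g = a + 2 ^ t) ∧
      ∀ R' g, 2 ^ q ≤ R' → R' < 2 ^ (q + 1) → R' ≠ R → g ≤ 2 ^ h →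
        ¬ OnHeapPath (gapLeft h R' g) (gapRight h R' g) w := by
  have hw0 : w ≠ 0 := by have := Nat.one_le_two_pow (n := q + 1); omega
  set l := Nat.log 2 w with hl
  have l1 : 2 ^ l ≤ w := Nat.pow_log_le_self 2 hw0
  have l2 : w < 2 ^ (l + 1) := Nat.lt_pow_succ_log_self (by norm_num) w
  have l3 : q + 1 < l + 1 := (Nat.pow_lt_pow_iff_right (by norm_num)).1 (hw.trans_lt l2)
  have l4 : l < q + h + 1 := (Nat.pow_lt_pow_iff_right (by norm_num)).1 (l1.trans_lt hw')
  obtain ⟨t, ht⟩ := Nat.exists_eq_add_of_le (show l ≤ q + h by omega)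
  obtain ⟨s, hs⟩ := Nat.exists_eq_add_of_le (show q ≤ l by omega)
  have hst : h = s + t := by omega
  have hpt : 0 < 2 ^ t := by positivity
  have hph : 0 < 2 ^ h := by positivity
  -- `R` is the ancestor of `w` on level `q`. The leaves below `w` are numbered `a, …, a + 2 ^ t -
  -- 1` within its subtree, and a gap path crosses `w` exactly at the two borders of this interval.
  set R := w / 2 ^ s with hR
  have r1 : R * 2 ^ s ≤ w := Nat.div_mul_le_self _ _
  have r2 : w < (R + 1) * 2 ^ s := by
    rw [Nat.add_one_mul]
    exact Nat.lt_div_mul_add (by positivity)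
  have r3 : R * 2 ^ h ≤ w * 2 ^ t := by
    rw [hst, pow_add, ← mul_assoc]; exact Nat.mul_le_mul_right _ r1
  have r4 : w * 2 ^ t + 2 ^ t ≤ R * 2 ^ h + 2 ^ h := by
    rw [← Nat.succ_mul, ← Nat.succ_mul, hst, pow_add, ← mul_assoc]
    exact Nat.mul_le_mul_right _ r2
  have R1 : 2 ^ q ≤ R := by
    rw [hR, Nat.le_div_iff_mul_le (by positivity), ← pow_add, ← hs]; exact l1
  have R2 : R < 2 ^ (q + 1) := by
    rw [hR, Nat.div_lt_iff_lt_mul (by positivity), ← pow_add, add_right_comm, ← hs]; exact l2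
  have leaf : ∀ x, 2 ^ (q + h) ≤ x → x < 2 ^ (q + h + 1) →
      (HeapDesc w x ↔ w * 2 ^ t ≤ x ∧ x < w * 2 ^ t + 2 ^ t) := fun x h1 h2 =>
    HeapDesc.iff_interval h1 h2 l1 l2 ht.symm
  have root : ∀ R', R' < 2 ^ (q + 1) → ¬ HeapDesc w R' := fun R' h1 h2 => by
    have := h2.le
    omega
  refine ⟨R, w * 2 ^ t - R * 2 ^ h, t, R1, R2, by omega, by omega, ?_, ?_⟩
  · intro g hg
    obtain ⟨b1, b2⟩ := subtree_bounds (h := h) R1 R2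
    unfold OnHeapPath gapLeft gapRight
    split_ifs with c1 c2 c2
    · simp only [root R R2, leaf (R * 2 ^ h + g) (by omega) (by omega), false_iff, not_not]
      omega
    · omega
    · rw [leaf (R * 2 ^ h + g - 1) (by omega) (by omega),
        leaf (R * 2 ^ h + g) (by omega) (by omega)]
      omega
    · simp only [root R R2, leaf (R * 2 ^ h + g - 1) (by omega) (by omega), iff_false,
        not_not]
      omega
  · intro R' g R1' R2' hne hg
    obtain ⟨b1, b2⟩ := subtree_bounds (h := h) R1' R2'
    have far : R' * 2 ^ h + 2 ^ h ≤ R * 2 ^ h ∨ R * 2 ^ h + 2 ^ h ≤ R' * 2 ^ h := by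
      rw [← Nat.succ_mul, ← Nat.succ_mul]
      rcases lt_or_gt_of_ne hne with h' | h'
      · exact Or.inl (Nat.mul_le_mul_right _ h')
      · exact Or.inr (Nat.mul_le_mul_right _ h')
    unfold OnHeapPath gapLeft gapRight
    split_ifs with c1 c2 c2
    · simp only [root R' R2', leaf (R' * 2 ^ h + g) (by omega) (by omega), false_iff, not_not]
      omega
    · omega
    · rw [leaf (R' * 2 ^ h + g - 1) (by omega) (by omega),
        leaf (R' * 2 ^ h + g) (by omega) (by omega)]
      omega
    · simp only [root R' R2', leaf (R' * 2 ^ h + g - 1) (by omega) (by omega), iff_false,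
        not_not]
      omega

namespace RainbowSep

variable {V : Type*} {G : SimpleGraph V}

theorem exists_isRSPS_of_family {ι : Type*} [Fintype ι] {k : ℕ} (P : ι → GraphPath G)
    (c : ι → Fin k)
    (h : ∀ e ∈ G.edgeSet, ∀ f ∈ G.edgeSet, e ≠ f → ∃ i j, c i ≠ c j ∧
      (e ∈ (P i).edges ∧ f ∉ (P i).edges) ∧ (f ∈ (P j).edges ∧ e ∉ (P j).edges)) :
    ∃ S : Multiset (GraphPath G), IsRSPS k S ∧ S.card = Fintype.card ι := by
  refine ⟨Finset.univ.val.map P, ⟨Finset.univ.val.map fun i => (P i, c i), ?_, ?_⟩, by simp⟩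
  · rw [Multiset.map_map]; rfl
  · intro e he f hf hne
    obtain ⟨i, j, hij, hi, hj⟩ := h e he f hf hne
    exact ⟨_, Multiset.mem_map_of_mem _ (Finset.mem_univ_val i), _,
      Multiset.mem_map_of_mem _ (Finset.mem_univ_val j), hij, hi, hj⟩

end RainbowSep

/-- The gap paths of the subtrees of height `h`, in distinct colours within each of them, together
with the edges above these subtrees in two colours, form a rainbow separating path system. -/
theorem HeapLabelling.exists_isRSPS {V : Type*} {G : SimpleGraph V} {q h k M : ℕ}
    (H : HeapLabelling G (q + h)) (hk : 2 ≤ k) (hM : h ≠ 0 → M = 2 ^ h + 1) (hMk : M ≤ k) :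
    ∃ S : Multiset (GraphPath G), IsRSPS k S ∧ S.card = 2 ^ q * (M + 4) := by
  choose path hpath using H.exists_path_between
  have hpath' : ∀ x y, (1 ≤ x ∧ x < 2 ^ (q + h + 1)) → (1 ≤ y ∧ y < 2 ^ (q + h + 1)) →
      ∀ w, 2 ≤ w → w < 2 ^ (q + h + 1) →
      (H.edge w ∈ (path (H.vert x) (H.vert y)).edges ↔ OnHeapPath x y w) := by
    intro x y hx hy w h1 h2
    rw [hpath _ _ w h1 h2, H.label_vert x hx.1 hx.2, H.label_vert y hy.1 hy.2, OnHeapPath]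
  -- The second summand ranges over the edges above the cut; its labels `0` and `1` name no edge and
  -- only add harmless paths. If `h = 0` there are no edges below the cut and `M` may be `0`.
  let ι := (Fin (2 ^ q) × Fin M) ⊕ (Fin (2 ^ (q + 1)) × Fin 2)
  let P : ι → GraphPath G := Sum.elim
    (fun i => path (H.vert (gapLeft h (2 ^ q + i.1) i.2)) (H.vert (gapRight h (2 ^ q + i.1) i.2)))
    (fun i => path (H.vert i.1) (H.vert (i.1 / 2)))
  let c : ι → Fin k := Sum.elim (fun i => Fin.castLE hMk i.2) (fun i => Fin.castLE hk i.2)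
  have hqh : 2 ^ (q + 1) ≤ 2 ^ (q + h + 1) := Nat.pow_le_pow_right (by norm_num) (by omega)
  have hq1 : 2 ^ (q + 1) = 2 * 2 ^ q := pow_succ' 2 q
  have hq0 : 1 ≤ 2 ^ q := Nat.one_le_two_pow
  have gap : ∀ R g, 2 ^ q ≤ R → R < 2 ^ (q + 1) → g ≤ 2 ^ h → h ≠ 0 → ∃ i : ι, (c i : ℕ) = g ∧
      ∀ w, 2 ≤ w → w < 2 ^ (q + h + 1) →
        (H.edge w ∈ (P i).edges ↔ OnHeapPath (gapLeft h R g) (gapRight h R g) w) := by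
    intro R g h1 h2 hg hh
    refine ⟨Sum.inl (⟨R - 2 ^ q, by omega⟩, ⟨g, by have := hM hh; omega⟩), rfl, ?_⟩
    intro w w1 w2
    obtain ⟨a, b⟩ := gap_bounds h1 h2 hg
    have e : 2 ^ q + (R - 2 ^ q) = R := by omega
    have := hpath' _ _ a b w w1 w2
    simpa only [P, Sum.elim_inl, e] using this
  have single : ∀ v (t : Fin 2), 2 ≤ v → v < 2 ^ (q + 1) → ∃ i : ι, (c i : ℕ) = t ∧
      ∀ w, 2 ≤ w → w < 2 ^ (q + h + 1) → (H.edge w ∈ (P i).edges ↔ w = v) := by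
    intro v t h1 h2
    refine ⟨Sum.inr (⟨v, h2⟩, t), rfl, ?_⟩
    intro w w1 w2
    rw [← onHeapPath_half (w := w) (v := v) (by omega)]
    exact hpath' v (v / 2) ⟨by omega, by omega⟩ ⟨by omega, by omega⟩ w w1 w2
  have mixed : ∀ w w', 2 ^ (q + 1) ≤ w → w < 2 ^ (q + h + 1) → 2 ≤ w' → w' < 2 ^ (q + 1) →
      ∃ i j, c i ≠ c j ∧ (H.edge w ∈ (P i).edges ∧ H.edge w' ∉ (P i).edges) ∧
        (H.edge w' ∈ (P j).edges ∧ H.edge w ∉ (P j).edges) := by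
    intro w w' h1 h2 h3 h4
    have hh : h ≠ 0 := by rintro rfl; simp at h2; omega
    obtain ⟨R, a, t, R1, R2, at1, -, on, -⟩ := exists_gaps h1 h2
    have tp : 0 < 2 ^ t := by positivity
    obtain ⟨i, ci, hi⟩ := gap R a R1 R2 (by omega) hh
    -- The gap path numbered `a` has colour `a`; the single edge is taken in whichever of the
    -- colours `0`, `1` differs from it.
    obtain ⟨j, cj, hj⟩ := single w' (if a = 0 then 1 else 0) h3 h4
    refine ⟨i, j, ?_, ⟨?_, ?_⟩, ?_, ?_⟩
    · intro hc
      have : (c i : ℕ) = c j := by rw [hc]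
      rw [ci, cj] at this
      split_ifs at this with h0
      · rw [h0] at this; simp at this
      · exact h0 this
    · rw [hi w (by omega) h2, on a (by omega)]; simp
    · rw [hi w' h3 (by omega)]; exact not_onHeapPath_gap_of_top R1 R2 (by omega) h4
    · rw [hj w' h3 (by omega)]
    · rw [hj w (by omega) h2]; omega
  have key : ∀ w w', 2 ≤ w → w < 2 ^ (q + h + 1) → 2 ≤ w' → w' < 2 ^ (q + h + 1) → w ≠ w' →
      ∃ i j, c i ≠ c j ∧ (H.edge w ∈ (P i).edges ∧ H.edge w' ∉ (P i).edges) ∧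
        (H.edge w' ∈ (P j).edges ∧ H.edge w ∉ (P j).edges) := by
    intro w w' h1 h2 h3 h4 hne
    rcases lt_or_ge w (2 ^ (q + 1)) with hw | hw
    · rcases lt_or_ge w' (2 ^ (q + 1)) with hw' | hw'
      · obtain ⟨i, ci, hi⟩ := single w 0 h1 hw
        obtain ⟨j, cj, hj⟩ := single w' 1 h3 hw'
        refine ⟨i, j, ?_, ⟨?_, ?_⟩, ?_, ?_⟩
        · intro hc
          have : (c i : ℕ) = c j := by rw [hc]
          rw [ci, cj] at this
          simp at this
        · rw [hi w h1 h2]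
        · rw [hi w' h3 h4]; exact hne.symm
        · rw [hj w' h3 h4]
        · rw [hj w h1 h2]; exact hne
      · obtain ⟨i, j, hij, a, b⟩ := mixed w' w hw' h4 h1 hw
        exact ⟨j, i, hij.symm, b, a⟩
    · rcases lt_or_ge w' (2 ^ (q + 1)) with hw' | hw'
      · exact mixed w w' hw h2 h3 hw'
      · have hh : h ≠ 0 := by rintro rfl; simp at h2; omega
        obtain ⟨R, a, t, R1, R2, at1, wt, on, off⟩ := exists_gaps hw h2
        obtain ⟨R', a', t', R1', R2', at1', wt', on', off'⟩ := exists_gaps hw' h4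
        have tp : 0 < 2 ^ t := by positivity
        have tp' : 0 < 2 ^ t' := by positivity
        -- In one subtree the two edges have distinct pairs of gaps, so each pair has an element
        -- outside the other. In different subtrees separation is automatic and only the colours
        -- have to differ.
        suffices ∃ g g', g ≤ 2 ^ h ∧ g' ≤ 2 ^ h ∧ g ≠ g' ∧ (g = a ∨ g = a + 2 ^ t) ∧
            (g' = a' ∨ g' = a' + 2 ^ t') ∧ (R = R' → ¬ (g = a' ∨ g = a' + 2 ^ t') ∧
              ¬ (g' = a ∨ g' = a + 2 ^ t)) by
          obtain ⟨g, g', hg, hg', hgg, ho, ho', hR⟩ := this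
          obtain ⟨i, ci, hi⟩ := gap R g R1 R2 hg hh
          obtain ⟨j, cj, hj⟩ := gap R' g' R1' R2' hg' hh
          refine ⟨i, j, ?_, ⟨?_, ?_⟩, ?_, ?_⟩
          · intro hc
            have : (c i : ℕ) = c j := by rw [hc]
            rw [ci, cj] at this
            exact hgg this
          · rw [hi w h1 h2, on g hg]; exact ho
          · rw [hi w' h3 h4]
            by_cases hRR : R = R'
            · rw [hRR, on' g hg]; exact (hR hRR).1
            · exact off' R g R1 R2 hRR hg
          · rw [hj w' h3 h4, on' g' hg']; exact ho'
          · rw [hj w h1 h2]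
            by_cases hRR : R = R'
            · rw [← hRR, on g' hg']; exact (hR hRR).2
            · exact off R' g' R1' R2' (Ne.symm hRR) hg'
        by_cases hRR : R = R'
        · have hdiff : ¬ (a = a' ∧ 2 ^ t = 2 ^ t') := by
            rintro ⟨e1, e2⟩
            rw [e2, hRR, e1, ← wt'] at wt
            exact hne (Nat.eq_of_mul_eq_mul_right tp' wt)
          by_cases e1 : a = a' ∨ a = a' + 2 ^ t'
          · refine ⟨a + 2 ^ t, ?_⟩
            by_cases e2 : a' = a ∨ a' = a + 2 ^ t
            · exact ⟨a' + 2 ^ t', by omega⟩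
            · exact ⟨a', by omega⟩
          · refine ⟨a, ?_⟩
            by_cases e2 : a' = a ∨ a' = a + 2 ^ t
            · exact ⟨a' + 2 ^ t', by omega⟩
            · exact ⟨a', by omega⟩
        · by_cases e : a = a'
          · exact ⟨a, a' + 2 ^ t', by omega⟩
          · exact ⟨a, a', by omega⟩
  obtain ⟨S, hS, hcard⟩ := exists_isRSPS_of_family P c (by
    intro e he f hf hne
    obtain ⟨w, h1, h2, rfl⟩ := H.exists_edge he
    obtain ⟨w', h3, h4, rfl⟩ := H.exists_edge hf
    exact key w w' h1 h2 h3 h4 (fun h => hne (by rw [h])))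
  refine ⟨S, hS, ?_⟩
  rw [hcard]
  simp only [ι, Fintype.card_sum, Fintype.card_prod, Fintype.card_fin]
  rw [hq1]
  ring

/-! ### Heaps are complete binary trees -/

namespace HeapLabelling

variable {V : Type*} {G : SimpleGraph V} {d : ℕ} (H : HeapLabelling G d)

/-- Every edge is a cut, so a closed trail can use no edge. -/
theorem isTree {V : Type*} {G : SimpleGraph V} {d : ℕ} (H : HeapLabelling G d) : G.IsTree := by
  refine ⟨H.connected, fun v p hp => ?_⟩
  have hno : ∀ e, e ∉ p.edges := by
    intro e he
    obtain ⟨w, h1, h2, rfl⟩ := H.exists_edge (p.edges_subset_edgeSet he)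
    rw [hp.isTrail.mem_edges_iff_of_cut (D := fun x => HeapDesc w (H.label x))
      (H.cut_edge h1 h2)] at he
    exact he Iff.rfl
  cases p with
  | nil => exact SimpleGraph.Walk.not_isCycle_nil hp
  | @cons _ u _ h p => exact hno s(v, u) (by simp)

theorem label_injective : Function.Injective H.label := fun u v h => by
  rw [← H.vert_label u, h, H.vert_label]

theorem deg_eq (v : V) : deg G v =
    {y | (y = H.label v / 2 ∨ H.label v = y / 2) ∧ 1 ≤ y ∧ y < 2 ^ (d + 1)}.ncard := by
  rw [deg, ← Set.ncard_image_of_injective _ H.label_injective]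
  congr 1
  ext y
  simp only [Set.mem_image, SimpleGraph.mem_neighborSet, Set.mem_ofPred_eq, H.adj_iff]
  constructor
  · rintro ⟨u, hu, rfl⟩
    exact ⟨hu.symm, H.label_pos u, H.label_lt u⟩
  · rintro ⟨hy, h1, h2⟩
    refine ⟨H.vert y, ?_⟩
    rw [H.label_vert y h1 h2]
    exact ⟨hy.symm, rfl⟩

theorem dist_root (v : V) : G.dist (H.vert 1) v = Nat.log 2 (H.label v) := by
  have hd1 : 1 < 2 ^ (d + 1) := Nat.one_lt_two_pow (by omega)
  apply le_antisymm
  · have key : ∀ m, 1 ≤ m → m < 2 ^ (d + 1) → G.dist (H.vert 1) (H.vert m) ≤ Nat.log 2 m := by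
      intro m
      induction m using Nat.strong_induction_on with
      | _ m ih =>
        intro h1 h2
        by_cases hm : m = 1
        · subst hm; simp
        · have h3 := ih (m / 2) (by omega) (by omega) (by omega)
          have h4 := H.edge_mem (w := m) (by omega) h2
          rw [edge, SimpleGraph.mem_edgeSet] at h4
          have h5 := H.connected.dist_triangle (u := H.vert 1) (v := H.vert (m / 2))
            (w := H.vert m)
          rw [SimpleGraph.dist_eq_one_iff_adj.2 h4.symm] at h5
          rw [Nat.log_of_one_lt_of_le (by norm_num) (by omega)]
          omega
    have := key _ (H.label_pos v) (H.label_lt v)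
    rwa [H.vert_label] at this
  · have key : ∀ {u v : V} (p : G.Walk u v),
        Nat.log 2 (H.label v) ≤ Nat.log 2 (H.label u) + p.length := by
      intro u v p
      induction p with
      | nil => simp
      | @cons u v w h p ih =>
        rw [SimpleGraph.Walk.length_cons]
        suffices Nat.log 2 (H.label v) ≤ Nat.log 2 (H.label u) + 1 by omega
        have := H.label_pos u
        rcases (H.adj_iff u v).1 h with h | h
        · rw [h, ← Nat.log_of_one_lt_of_le (by norm_num) (by omega)]
        · rw [h]
          exact (Nat.log_mono_right (Nat.div_le_self _ _)).trans (Nat.le_succ _)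
    obtain ⟨p, hp⟩ := H.connected.exists_walk_length_eq_dist (H.vert 1) v
    have := key p
    rw [H.label_vert 1 le_rfl hd1] at this
    simpa [hp] using this

theorem isCompleteBinaryTree {V : Type*} {G : SimpleGraph V} {d : ℕ} (H : HeapLabelling G d)
    (hd : 1 ≤ d) : IsCompleteBinaryTree G := by
  have hp : 2 ^ (d + 1) = 2 * 2 ^ d := pow_succ' 2 d
  have hd2 : 2 ^ 1 ≤ 2 ^ d := Nat.pow_le_pow_right (by norm_num) hd
  have root : ∀ v, H.label v = 1 → deg G v = 2 := by
    intro v hv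
    rw [H.deg_eq, hv, Set.ncard_eq_two]
    refine ⟨2, 3, by norm_num, ?_⟩
    ext y
    simp only [Set.mem_ofPred_eq, Set.mem_insert_iff, Set.mem_singleton_iff]
    omega
  have inner : ∀ v, H.label v ≠ 1 → H.label v < 2 ^ d → deg G v = 3 := by
    intro v h1 h2
    have := H.label_pos v
    rw [H.deg_eq, Set.ncard_eq_three]
    refine ⟨H.label v / 2, 2 * H.label v, 2 * H.label v + 1, by omega, by omega, by omega, ?_⟩
    ext y
    simp only [Set.mem_ofPred_eq, Set.mem_insert_iff, Set.mem_singleton_iff]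
    omega
  have leaf : ∀ v, 2 ^ d ≤ H.label v → deg G v = 1 := by
    intro v h1
    have := H.label_lt v
    rw [H.deg_eq, Set.ncard_eq_one]
    refine ⟨H.label v / 2, ?_⟩
    ext y
    simp only [Set.mem_ofPred_eq, Set.mem_singleton_iff]
    omega
  refine ⟨H.isTree, H.vert 1, Or.inr (root _ (H.label_vert 1 le_rfl (by omega))), ?_, d, ?_⟩
  · intro v hv
    have h1 : H.label v ≠ 1 := fun h => hv ((H.vert_eq_iff le_rfl (by omega)).2 h)
    rcases lt_or_ge (H.label v) (2 ^ d) with h | h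
    exacts [Or.inr (inner v h1 h), Or.inl (leaf v h)]
  · intro v hv
    rw [H.dist_root]
    have h1 : H.label v ≠ 1 := fun h => by rw [root v h] at hv; omega
    have h2 : 2 ^ d ≤ H.label v := by
      by_contra hlt
      rw [inner v h1 (by omega)] at hv
      omega
    exact (Nat.log_eq_iff (Or.inl (by omega))).2 ⟨h2, H.label_lt v⟩

end HeapLabelling

/-- The heap on `2 ^ (d + 1) - 1` vertices. -/
def heapGraph (d : ℕ) : SimpleGraph (Fin (2 ^ (d + 1) - 1)) where
  Adj u v := (u : ℕ) + 1 = (v + 1) / 2 ∨ (v : ℕ) + 1 = (u + 1) / 2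
  symm := ⟨fun _ _ h => h.symm⟩
  loopless := ⟨fun u h => by omega⟩

/-- The labelling of the heap. -/
def heapGraphLabelling (d : ℕ) : HeapLabelling (heapGraph d) d where
  label v := v + 1
  vert m := ⟨(m - 1) % (2 ^ (d + 1) - 1), Nat.mod_lt _ (by
    have := Nat.one_lt_two_pow (n := d + 1) (by omega); omega)⟩
  label_pos v := by omega
  label_lt v := by omega
  vert_label v := by
    ext
    simp [Nat.mod_eq_of_lt v.2]
  label_vert m h1 h2 := by
    have : (m - 1) % (2 ^ (d + 1) - 1) = m - 1 := Nat.mod_eq_of_lt (by omega)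
    change (m - 1) % (2 ^ (d + 1) - 1) + 1 = m
    omega
  adj_iff u v := Iff.rfl

/-! ### The class as a filter, and comparison of the separation numbers -/

namespace RainbowSep

/-- Makes the filter behind `classRatio` nontrivial; otherwise an eventual lower bound would say
nothing about the upper limit. -/
theorem infinite_completeBinaryTrees : completeBinaryTrees.Infinite := by
  refine Set.infinite_of_injective_forall_mem
    (f := fun d : ℕ => (⟨2 ^ (d + 1 + 1) - 1, heapGraph (d + 1)⟩ : FinGraph)) ?_ ?_
  · intro a b hab
    have h := congrArg Sigma.fst hab
    simp only at h
    have h1 := Nat.one_le_two_pow (n := a + 1 + 1)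
    have h2 := Nat.one_le_two_pow (n := b + 1 + 1)
    have h3 : 2 ^ (a + 1 + 1) = 2 ^ (b + 1 + 1) := by omega
    have := Nat.pow_right_injective le_rfl h3
    omega
  · intro d
    exact (heapGraphLabelling (d + 1)).isCompleteBinaryTree (by omega)

instance : (cofinite ⊓ 𝓟 completeBinaryTrees).NeBot :=
  infinite_completeBinaryTrees.cofinite_inf_principal_neBot

theorem eventually_of_order_ge {A : Set FinGraph} {p : FinGraph → Prop} (n₀ : ℕ)
    (h : ∀ G ∈ A, n₀ ≤ G.1 → p G) : ∀ᶠ G in cofinite ⊓ 𝓟 A, p G := by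
  rw [eventually_inf_principal, eventually_cofinite]
  have hfin : (Set.range fun x : Σ i : Fin n₀, SimpleGraph (Fin i) =>
      (⟨x.1, x.2⟩ : FinGraph)).Finite := Set.finite_range _
  refine hfin.subset ?_
  rintro ⟨n, G⟩ hG
  simp only [Set.mem_ofPred_eq, Classical.not_imp] at hG
  have : n < n₀ := by
    by_contra hlt
    exact hG.2 (h _ hG.1 (not_lt.1 hlt))
  exact ⟨⟨⟨n, this⟩, G⟩, rfl⟩

/-- Forgetting colours and multiplicities preserves separation. -/
theorem IsRSPS.exists_isStronglySeparating {V : Type*} {G : SimpleGraph V} {k : ℕ}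
    {S : Multiset (GraphPath G)} (hS : IsRSPS k S) :
    ∃ S' : Finset (GraphPath G), IsStronglySeparating S' ∧ S'.card ≤ S.card := by
  classical
  obtain ⟨C, rfl, hC⟩ := hS
  refine ⟨(C.map Prod.fst).toFinset, ?_, Multiset.toFinset_card_le _⟩
  intro e he f hf hne
  obtain ⟨P, hP, -, -, -, h, -⟩ := hC e he f hf hne
  exact ⟨P.1, by rw [Multiset.mem_toFinset]; exact Multiset.mem_map_of_mem _ hP, h⟩

theorem rainbowSepNumber_top {V : Type*} (G : SimpleGraph V) : rainbowSepNumber G ⊤ = ssp G :=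
  if_pos rfl

theorem rainbowSepNumber_coe {V : Type*} (G : SimpleGraph V) (k : ℕ) :
    rainbowSepNumber G k =
      sInf {m | ∃ S : Multiset (GraphPath G), IsRSPS k S ∧ S.card = m} := by
  rw [rainbowSepNumber, if_neg (ENat.natCast_ne_top k), ENat.toNat_natCast]

theorem IsRSPS.ssp_le_card {V : Type*} {G : SimpleGraph V} {k : ℕ}
    {S : Multiset (GraphPath G)} (hS : IsRSPS k S) : ssp G ≤ S.card := by
  obtain ⟨S', h1, h2⟩ := hS.exists_isStronglySeparating
  have : ssp G ≤ S'.card := Nat.sInf_le ⟨S', h1, rfl⟩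
  exact this.trans h2

end RainbowSep

/-! ### Choice of parameters and numerical bounds -/

namespace HeapLabelling

/-- For any number of colours there is an economical rainbow separating path system. -/
theorem exists_small_isRSPS {k : ℕ} (hk : 2 ≤ k) {V : Type*} {G : SimpleGraph V} {d : ℕ}
    (H : HeapLabelling G d) (hd : k ≤ d) : ∃ S : Multiset (GraphPath G), IsRSPS k S ∧
      k * S.card ≤ 2 ^ d * (k + 6 + 2 * Nat.log 2 k) ∧ k * S.card ≤ 2 ^ d * (k + 10) := by
  rcases eq_or_lt_of_le hk with rfl | hk3
  -- With two colours gap paths are of no use: every edge is taken singly in both colours.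
  · obtain ⟨S, hS, hc⟩ := HeapLabelling.exists_isRSPS (q := d) (h := 0) (M := 0) H le_rfl
      (fun h => absurd rfl h) (by omega)
    have hl : Nat.log 2 2 = 1 := by decide
    exact ⟨S, hS, by rw [hc, hl]; omega, by rw [hc]; omega⟩
  -- The largest `h` with `2 ^ h + 1 ≤ k`, so that `k ≤ 2 * 2 ^ h`.
  · set h := Nat.log 2 (k - 1) with hh
    have h1 : 2 ^ h ≤ k - 1 := Nat.pow_log_le_self 2 (by omega)
    have h2 : k - 1 < 2 ^ (h + 1) := Nat.lt_pow_succ_log_self (by norm_num) _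
    have hhd : h ≤ d := by
      have := Nat.lt_two_pow_self (n := h)
      omega
    obtain ⟨q, rfl⟩ := Nat.exists_eq_add_of_le' hhd
    obtain ⟨S, hS, hc⟩ := H.exists_isRSPS (M := 2 ^ h + 1) hk (fun _ => rfl) (by omega)
    have hp : 2 ^ (h + 1) = 2 * 2 ^ h := pow_succ' 2 h
    have e1 : k * S.card = 2 ^ q * (k * (2 ^ h + 5)) := by rw [hc]; ring
    have big : k * (2 ^ h + 5) ≤ 2 ^ h * (k + 10) := by
      have : k ≤ 2 * 2 ^ h := by omega
      nlinarith
    refine ⟨S, hS, ?_, ?_⟩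
    · rw [e1, pow_add, mul_assoc]
      refine Nat.mul_le_mul_left _ ?_
      -- From `k = 4` on, `6 + 2 * Nat.log 2 k` is at least `10`; for `k = 3` the estimate `big` is
      -- too weak and the numbers are compared directly.
      rcases eq_or_lt_of_le (show 3 ≤ k from hk3) with rfl | hk4
      · have hl : Nat.log 2 3 = 1 := by decide
        have hl2 : h = 1 := by rw [hh]; decide
        rw [hl, hl2]; norm_num
      · have hl : 2 ≤ Nat.log 2 k := Nat.le_log_of_pow_le (by norm_num) (by omega)
        exact big.trans (Nat.mul_le_mul_left _ (by omega))
    · rw [e1, pow_add, mul_assoc]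
      exact Nat.mul_le_mul_left _ big

theorem two_pow_le_ssp {V : Type*} {G : SimpleGraph V} {d : ℕ} (H : HeapLabelling G d)
    (hd : 2 ≤ d) : 2 ^ d ≤ ssp G := by
  -- Some separating system must be exhibited, since the infimum of the empty set would be `0`.
  obtain ⟨S, hS, -⟩ := H.exists_small_isRSPS le_rfl hd
  obtain ⟨S', h1, -⟩ := hS.exists_isStronglySeparating
  obtain ⟨S'', h2, h3⟩ := Nat.sInf_mem (s := {m | ∃ S : Finset (GraphPath G),
    IsStronglySeparating S ∧ S.card = m}) ⟨_, S', h1, rfl⟩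
  rw [ssp, ← h3]
  exact H.two_pow_le_card_of_isStronglySeparating hd h2

/-- The surplus forced by `k` colours is a fraction `2 ^ -(k + 1)` of the number of leaves. The
construction with `2 ^ (k + 10)` colours shows that `ssp G` exceeds the number of leaves by a
fraction of at most `10 / 2 ^ (k + 10)`, which is much smaller. That construction is why `d` has to
be so large. -/
theorem lower_bound {V : Type*} {G : SimpleGraph V} {d k : ℕ} (H : HeapLabelling G d)
    (hk : 2 ≤ k) (hd : 2 ^ (k + 10) ≤ d) {S : Multiset (GraphPath G)} (hS : IsRSPS k S) :
    (1 + 1 / (16 : ℝ) ^ (k + 6)) * (ssp G : ℝ) ≤ (S.card : ℝ) := by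
  have hkd : k + 10 < d := lt_of_lt_of_le Nat.lt_two_pow_self hd
  obtain ⟨t, ht⟩ := Nat.exists_eq_add_of_le (show k ≤ d by omega)
  have h1 := H.rainbow_le_card_of_isRSPS (by omega) ht.symm (by omega) hS
  have hK : 2 ≤ 2 ^ (k + 10) := by
    calc 2 = 2 ^ 1 := rfl
      _ ≤ _ := Nat.pow_le_pow_right (by norm_num) (by omega)
  obtain ⟨S', hS', -, h2⟩ := H.exists_small_isRSPS hK hd
  have h3 := hS'.ssp_le_card
  have h4 : 2 ^ (k + 10) * ssp G ≤ 2 ^ d * (2 ^ (k + 10) + 10) :=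
    (Nat.mul_le_mul_left _ h3).trans h2
  rw [ht] at h4
  have r1 : (2 : ℝ) ^ t * (2 ^ (k + 1) + 1) ≤ 2 * S.card := by exact_mod_cast h1
  have r2 : (2 : ℝ) ^ (k + 10) * ssp G ≤ 2 ^ (k + t) * (2 ^ (k + 10) + 10) := by
    exact_mod_cast h4
  have hx : (1 : ℝ) ≤ 2 ^ k := one_le_pow₀ (by norm_num)
  have hy : (0 : ℝ) < 2 ^ t := by positivity
  have h16 : 1 / (16 : ℝ) ^ (k + 6) ≤ 1 / (1024 * 2 ^ k) := by
    apply one_div_le_one_div_of_le (by positivity)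
    rw [pow_add, mul_comm]
    have : (2 : ℝ) ^ k ≤ 16 ^ k := pow_le_pow_left₀ (by norm_num) (by norm_num) k
    have : (16 : ℝ) ^ 6 = 16777216 := by norm_num
    nlinarith
  rw [pow_add, pow_add] at r2
  rw [pow_succ] at r1
  -- In these terms `ssp G ≤ y * (x + 10 / 1024)` and `y * (x + 1 / 2) ≤ S.card`; the factor `1 + 1
  -- / (1024 * x)` adds less than the remaining gap.
  set x := (2 : ℝ) ^ k
  set y := (2 : ℝ) ^ t
  norm_num at r2
  have r3 : (ssp G : ℝ) ≤ y * (x + 10 / 1024) := by nlinarith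
  calc (1 + 1 / (16 : ℝ) ^ (k + 6)) * (ssp G : ℝ)
      ≤ (1 + 1 / (1024 * x)) * (y * (x + 10 / 1024)) := by gcongr
    _ ≤ y * (x + 1 / 2) := by
        have : (1 + 1 / (1024 * x)) * (y * (x + 10 / 1024)) =
          y * (x + 10 / 1024 + 1 / 1024 + (10 / 1024 / 1024) * (1 / x)) := by field_simp; ring
        rw [this]
        have : 1 / x ≤ 1 := by rw [div_le_one (by positivity)]; exact hx
        exact mul_le_mul_of_nonneg_left (by linarith) hy.le
    _ ≤ S.card := by nlinarith

end HeapLabelling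

/-! ### Bounds for the ratios and the main theorem -/

namespace RainbowSep

theorem IsCompleteBinaryTree.exists_labelling {n : ℕ} {G : SimpleGraph (Fin n)}
    (hG : IsCompleteBinaryTree G) {D : ℕ} (hn : 2 ^ (D + 1) ≤ n) :
    ∃ d, D ≤ d ∧ n + 1 = 2 ^ (d + 1) ∧ Nonempty (HeapLabelling G d) := by
  have h2 : 2 ^ 1 ≤ 2 ^ (D + 1) := Nat.pow_le_pow_right (by norm_num) (by omega)
  have : Nontrivial (Fin n) := Fin.nontrivial_iff_two_le.2 (by omega)
  obtain ⟨d, ⟨H⟩⟩ := hG.exists_heapLabelling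
  have hc := H.card_eq
  rw [Fintype.card_fin] at hc
  have hp := Nat.one_le_two_pow (n := d + 1)
  refine ⟨d, ?_, by omega, ⟨H⟩⟩
  have : 2 ^ (D + 1) < 2 ^ (d + 1) := by omega
  have := (Nat.pow_lt_pow_iff_right (by norm_num)).1 this
  omega

theorem ratio_bounds {k : ℕ} (hk : 2 ≤ k) {n : ℕ} {G : SimpleGraph (Fin n)}
    (hG : IsCompleteBinaryTree G) (hn : 2 ^ (2 ^ (k + 10) + 1) ≤ n) :
    ENNReal.ofReal (1 + 1 / (16 : ℝ) ^ (k + 6)) ≤ ratio G k ∧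
      ratio G k ≤ ENNReal.ofReal (1 + 10 / k) := by
  obtain ⟨d, hd, -, ⟨H⟩⟩ := hG.exists_labelling hn
  have hkd : k + 10 < d := lt_of_lt_of_le Nat.lt_two_pow_self hd
  have hs := H.two_pow_le_ssp (by omega)
  obtain ⟨S, hS, -, hc⟩ := H.exists_small_isRSPS hk (by omega)
  have hpos : 0 < ssp G := lt_of_lt_of_le (by positivity) hs
  -- A system attaining the minimum, to which the lower bound is applied.
  obtain ⟨S', hS', hm⟩ := Nat.sInf_mem (s := {m | ∃ S : Multiset (GraphPath G),
    IsRSPS k S ∧ S.card = m}) ⟨_, S, hS, rfl⟩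
  have hle : rainbowSepNumber G k ≤ S.card := by
    rw [rainbowSepNumber_coe]; exact Nat.sInf_le ⟨S, hS, rfl⟩
  rw [← rainbowSepNumber_coe] at hm
  rw [ratio, rainbowSepNumber_top]
  have hne : (ssp G : ℝ≥0∞) ≠ 0 := by exact_mod_cast hpos.ne'
  have hnt : (ssp G : ℝ≥0∞) ≠ ⊤ := ENNReal.natCast_ne_top _
  constructor
  · rw [ENNReal.le_div_iff_mul_le (Or.inl hne) (Or.inl hnt), ← ENNReal.ofReal_natCast,
      ← ENNReal.ofReal_natCast, ← ENNReal.ofReal_mul (by positivity), ← hm]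
    exact ENNReal.ofReal_le_ofReal (H.lower_bound hk hd hS')
  · rw [ENNReal.div_le_iff hne hnt, ← ENNReal.ofReal_natCast,
      ← ENNReal.ofReal_natCast, ← ENNReal.ofReal_mul (by positivity)]
    refine ENNReal.ofReal_le_ofReal ?_
    have h1 : k * rainbowSepNumber G k ≤ ssp G * (k + 10) :=
      (Nat.mul_le_mul_left _ hle).trans (hc.trans (Nat.mul_le_mul_right _ hs))
    have h2 : (k : ℝ) * rainbowSepNumber G k ≤ ssp G * (k + 10) := by exact_mod_cast h1
    have hk0 : (0 : ℝ) < k := by positivity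
    have : (1 + 10 / (k : ℝ)) * ssp G = ssp G * (k + 10) / k := by field_simp
    rw [this, le_div_iff₀ hk0]
    linarith

theorem classRatio_bounds {k : ℕ} (hk : 2 ≤ k) :
    ENNReal.ofReal (1 + 1 / (16 : ℝ) ^ (k + 6)) ≤ classRatio completeBinaryTrees k ∧
      classRatio completeBinaryTrees k ≤ ENNReal.ofReal (1 + 10 / k) := by
  have h : ∀ᶠ G : FinGraph in cofinite ⊓ 𝓟 completeBinaryTrees,
      ENNReal.ofReal (1 + 1 / (16 : ℝ) ^ (k + 6)) ≤ ratio G.2 k ∧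
        ratio G.2 k ≤ ENNReal.ofReal (1 + 10 / k) :=
    eventually_of_order_ge _ fun G hG hn => ratio_bounds hk hG hn
  exact ⟨le_limsup_of_frequently_le (h.mono fun _ h => h.1).frequently,
    limsup_le_of_le (by isBoundedDefault) (h.mono fun _ h => h.2)⟩

/-- The lower bound on the ratio depends on `k` only, so it stays strictly above `1` in the upper
limit. -/
theorem one_lt_classRatio {k : ℕ} (hk : 2 ≤ k) : 1 < classRatio completeBinaryTrees k := by
  refine lt_of_lt_of_le ?_ (classRatio_bounds hk).1
  rw [ENNReal.one_lt_ofReal]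
  have : (0 : ℝ) < 1 / 16 ^ (k + 6) := by positivity
  linarith

theorem tendsto_classRatio :
    Tendsto (fun k : ℕ => classRatio completeBinaryTrees (k : ℕ∞)) atTop (𝓝 1) := by
  have hlim : Tendsto (fun k : ℕ => ENNReal.ofReal (1 + 10 / (k : ℝ))) atTop (𝓝 1) := by
    have h1 : Tendsto (fun k : ℕ => 1 + 10 / (k : ℝ)) atTop (𝓝 (1 + 0)) :=
      tendsto_const_nhds.add (tendsto_const_div_atTop_nhds_zero_nat 10)
    have := ENNReal.tendsto_ofReal h1
    simpa using this
  refine tendsto_of_tendsto_of_tendsto_of_le_of_le' tendsto_const_nhds hlim ?_ ?_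
  · filter_upwards [eventually_ge_atTop 2] with k hk using (one_lt_classRatio hk).le
  · filter_upwards [eventually_ge_atTop 2] with k hk using (classRatio_bounds hk).2

end RainbowSep

theorem mainTheorem2 :
    IsRainbowSeparable completeBinaryTrees ∧
    chromaticSepNumber completeBinaryTrees = ⊤ ∧
    (∀ k : ℕ, 2 ≤ k → ∃ n₀ : ℕ, ∀ n : ℕ, n₀ ≤ n → ∀ G : SimpleGraph (Fin n),
      IsCompleteBinaryTree G → ∀ S : Multiset (GraphPath G), IsRSPS k S →
        (1 + 1 / (16 : ℝ) ^ (k + 6)) * (rainbowSepNumber G ⊤ : ℝ) ≤ (S.card : ℝ)) ∧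
    (∀ k : ℕ, 2 ≤ k → ∃ n₀ : ℕ, ∀ n : ℕ, n₀ ≤ n → ∀ G : SimpleGraph (Fin n),
      IsCompleteBinaryTree G → ∃ S : Multiset (GraphPath G), IsRSPS k S ∧
        (S.card : ℝ) ≤ ((n : ℝ) + 1) / k * (((k : ℝ) + 2 * Real.logb 2 k + 6) / 2)) ∧
    Tendsto (fun k : ℕ => classRatio completeBinaryTrees (k : ℕ∞)) atTop (𝓝 1) := by
  refine ⟨?_, ?_, ?_, ?_, tendsto_classRatio⟩
  · intro ε hε
    have h1 : (1 : ℝ≥0∞) < 1 + ENNReal.ofReal ε :=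
      ENNReal.lt_add_right ENNReal.one_ne_top (ENNReal.ofReal_pos.2 hε).ne'
    obtain ⟨k, h2, h3⟩ :=
      ((tendsto_classRatio.eventually_lt_const h1).and (eventually_ge_atTop 2)).exists
    exact ⟨k, h3, h2⟩
  -- It suffices that no finite `k` is admissible.
  · rw [chromaticSepNumber, sInf_eq_top]
    rintro k ⟨hk, hk1⟩
    by_contra hne
    lift k to ℕ using hne
    exact (one_lt_classRatio (by exact_mod_cast hk)).ne' hk1
  · intro k hk
    refine ⟨2 ^ (2 ^ (k + 10) + 1), fun n hn G hG S hS => ?_⟩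
    obtain ⟨d, hd, -, ⟨H⟩⟩ := hG.exists_labelling hn
    rw [rainbowSepNumber_top]
    exact H.lower_bound hk hd hS
  · intro k hk
    refine ⟨2 ^ (k + 1), fun n hn G hG => ?_⟩
    obtain ⟨d, hd, hnd, ⟨H⟩⟩ := hG.exists_labelling hn
    obtain ⟨S, hS, hc, -⟩ := H.exists_small_isRSPS hk hd
    refine ⟨S, hS, ?_⟩
    have h1 : (k : ℝ) * S.card ≤ 2 ^ d * (k + 6 + 2 * Nat.log 2 k) := by exact_mod_cast hc
    have h2 : (n : ℝ) + 1 = 2 ^ d * 2 := by rw [← pow_succ]; exact_mod_cast hnd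
    have h3 : (Nat.log 2 k : ℝ) ≤ Real.logb 2 k := by exact_mod_cast Real.natLog_le_logb k 2
    have hk0 : (0 : ℝ) < k := by positivity
    rw [h2, div_mul_eq_mul_div, le_div_iff₀ hk0]
    calc (S.card : ℝ) * k ≤ 2 ^ d * (k + 6 + 2 * Nat.log 2 k) := by linarith
      _ ≤ 2 ^ d * (k + 6 + 2 * Real.logb 2 k) := by gcongr
      _ = _ := by ring
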